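/- Let $d_1,d_2$ be distinct square-free integers different from $1$, let $\overline{\mathbb Q}$ be an algebraic closure of $\mathbb Q$ containing fixed square roots $\sqrt{d_1},\sqrt{d_2}$, and put $\sqrt{d_1d_2}=\sqrt{d_1}\sqrt{d_2}$ and $K=\mathbb Q(\sqrt{d_1},\sqrt{d_2})$. A $D_4$-extension is a Galois extension $F/\mathbb Q$ with $F\subset\overline{\mathbb Q}$ whose Galois group is dihedral of order $8$. Write $(a/n)$ for the Kronecker symbol, $\eta(a,b)=(-1)^{\frac{a-1}{2}\cdot\frac{b-1}{2}}$ for odd integers $a,b$, and $d_{i,p}=d_i/p^{\alpha}$, where $p^{\alpha}$ is the exact power of the prime $p$ dividing $d_i$. Consider the following three sets of conditions. (i) $(\operatorname{sign} d_1,\operatorname{sign} d_2)\neq(+1,-1)$, and for every prime $p$: $$\begin{array}{r|c|c} & p>2 & p=2\\\hline p\nmid d_1,\ p\nmid d_2 & \text{no condition} & \eta(d_1+2,d_2)=1\\ p\mid d_1,\ p\nmid d_2 & \left(\frac{d_2}{p}\right)=1 & \eta(d_{1,2}+2,d_2)\left(\frac{2}{d_2}\right)=1\\ p\nmid d_1,\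 p\mid d_2 & \left(\frac{-d_1}{p}\right)=1 & \eta(d_1+2,d_{2,2})\left(\frac{2}{d_1}\right)=1\\ p\mid d_1,\ p\mid d_2 & \left(\frac{d_{1,p}d_{2,p}}{p}\right)=1 & \eta(d_{1,2}+2,d_{2,2})\left(\frac{2}{d_{1,2}d_{2,2}}\right)=1 \end{array}$$ (ii) $(\operatorname{sign} d_1,\operatorname{sign} d_2)\neq(-1,+1)$, and for every prime $p$: $$\begin{array}{r|c|c} & p>2 & p=2\\\hline p\nmid d_1,\ p\nmid d_2 & \text{no condition} & \eta(d_1,d_2+2)=1\\ p\mid d_1,\ p\nmid d_2 & \left(\frac{-d_2}{p}\right)=1 & \eta(d_{1,2},d_2+2)\left(\frac{2}{d_2}\right)=1\\ p\nmid d_1,\ p\mid d_2 & \left(\frac{d_1}{p}\right)=1 & \eta(d_1,d_{2,2}+2)\left(\frac{2}{d_1}\right)=1\\ p\mid d_1,\ p\mid d_2 & \left(\frac{d_{1,p}d_{2,p}}{p}\right)=1 & \eta(d_{1,2},d_{2,2}+2)\left(\frac{2}{d_{1,2}d_{2,2}}\right)=1 \end{array}$$ (iii) $(\operatorname{sign}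 d_1,\operatorname{sign} d_2)\neq(-1,-1)$, and for every prime $p$: $$\begin{array}{r|c|c} & p>2 & p=2\\\hline p\nmid d_1,\ p\nmid d_2 & \text{no condition} & \eta(d_1,d_2)=1\\ p\mid d_1,\ p\nmid d_2 & \left(\frac{d_2}{p}\right)=1 & \eta(d_{1,2},d_2)\left(\frac{2}{d_2}\right)=1\\ p\nmid d_1,\ p\mid d_2 & \left(\frac{d_1}{p}\right)=1 & \eta(d_1,d_{2,2})\left(\frac{2}{d_1}\right)=1\\ p\mid d_1,\ p\mid d_2 & \left(\frac{-d_{1,p}d_{2,p}}{p}\right)=1 & \eta(d_{1,2},d_{2,2})\left(\frac{2}{d_{1,2}d_{2,2}}\right)=1 \end{array}$$ Then $K$ is contained in a $D_4$-extension if and only if all conditions of at least one of (i), (ii), (iii) hold. More precisely, $K$ is contained in a $D_4$-extension $F/\mathbb Q$ such that $F$ is cyclic over $\mathbb Q(\sqrt{d_1})$, respectively $\mathbb Q(\sqrt{d_2})$, respectively $\mathbb Q(\sqrt{d_1d_2})$, if and only if (i), respectively (ii), respectively (iii) holds. Moreover, let $(a,b)_v$ denote the Hilbert symbol over $\mathbb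 Q_v$ (with $\mathbb Q_\infty=\mathbb R$), which is $1$ if $ax^2+by^2=z^2$ has a solution $(x,y,z)\ne(0,0,0)$ in $\mathbb Q_v^3$, and $-1$ otherwise. Then these three properties are equivalent, respectively, to $(d_2,d_1d_2)_v=1$, to $(d_1,d_1d_2)_v=1$, and to $(d_1,d_2)_v=1$ for all places $v$ of $\mathbb Q$. The correspondence holds place by place: the sign condition of each case is equivalent to the triviality of the respective Hilbert symbol at $v=\infty$, and the condition of its table at a prime $p$ is equivalent to the triviality of that symbol at $v=p$. -/

import Mathlib

open scoped IntermediateField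

namespace BiquadraticD4

/-! ### Quadratic symbols -/

/-- The Kronecker symbol `(a / n)`, for arbitrary integers `a` and `n`. It is multiplicative in `n`,
with `(a / 0) = 1` or `0` according to whether `a = ±1` or not, `(a / -1) = -1` or `1` according to
whether `a < 0` or not, `(a / 2) = 0`, `1`, `-1` according to whether `a` is even, `a ≡ ±1 mod 8` or
`a ≡ ±3 mod 8` (this is the value of the character `χ₈` at `a`), and `(a / n)` the Jacobi symbol for
positive odd `n`. -/
def kroneckerSymbol (a n : ℤ) : ℤ :=
  if n = 0 then (if a.natAbs = 1 then 1 else 0)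
  else (if n < 0 ∧ a < 0 then -1 else 1) *
    ZMod.χ₈ (a : ZMod 8) ^ padicValNat 2 n.natAbs *
    jacobiSym a (n.natAbs / 2 ^ padicValNat 2 n.natAbs)

/-- The part of the non-zero integer `E` that is prime to `p`: the quotient `E / p ^ α`, where
`p ^ α` is the exact power of `p` that divides `E`. -/
def primeToPart (p : ℕ) (E : ℤ) : ℤ :=
  E / (p : ℤ) ^ padicValInt p E

/-- `η(a, b) = (-1) ^ ((a - 1) / 2 * ((b - 1) / 2))`, for odd integers `a` and `b`
of arbitrary sign. -/
def eta (a b : ℤ) : ℤ :=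
  ((((a - 1) / 2) * ((b - 1) / 2)).negOnePow : ℤˣ)

/-- The pairs of distinct square-free integers different from `1`. -/
def IsAdmissiblePair (d₁ d₂ : ℤ) : Prop :=
  Squarefree d₁ ∧ Squarefree d₂ ∧ d₁ ≠ 1 ∧ d₂ ≠ 1 ∧ d₁ ≠ d₂

/-! ### The three tables of local conditions at a prime `p` -/

/-- The condition at the prime `p` in the case "cyclic over `ℚ(√d₁)`". -/
def localConditionFst (d₁ d₂ : ℤ) (p : ℕ) : Prop :=
  (2 < p →
    (((p : ℤ) ∣ d₁ ∧ ¬ (p : ℤ) ∣ d₂) → kroneckerSymbol d₂ p = 1) ∧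
    ((¬ (p : ℤ) ∣ d₁ ∧ (p : ℤ) ∣ d₂) → kroneckerSymbol (-d₁) p = 1) ∧
    (((p : ℤ) ∣ d₁ ∧ (p : ℤ) ∣ d₂) →
      kroneckerSymbol (primeToPart p d₁ * primeToPart p d₂) p = 1)) ∧
  (p = 2 →
    ((¬ 2 ∣ d₁ ∧ ¬ 2 ∣ d₂) → eta (d₁ + 2) d₂ = 1) ∧
    ((2 ∣ d₁ ∧ ¬ 2 ∣ d₂) → eta (primeToPart 2 d₁ + 2) d₂ * kroneckerSymbol 2 d₂ = 1) ∧
    ((¬ 2 ∣ d₁ ∧ 2 ∣ d₂) → eta (d₁ + 2) (primeToPart 2 d₂) * kroneckerSymbol 2 d₁ = 1) ∧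
    ((2 ∣ d₁ ∧ 2 ∣ d₂) → eta (primeToPart 2 d₁ + 2) (primeToPart 2 d₂) *
      kroneckerSymbol 2 (primeToPart 2 d₁ * primeToPart 2 d₂) = 1))

/-- The condition at the prime `p` in the case "cyclic over `ℚ(√d₂)`". -/
def localConditionSnd (d₁ d₂ : ℤ) (p : ℕ) : Prop :=
  (2 < p →
    (((p : ℤ) ∣ d₁ ∧ ¬ (p : ℤ) ∣ d₂) → kroneckerSymbol (-d₂) p = 1) ∧
    ((¬ (p : ℤ) ∣ d₁ ∧ (p : ℤ) ∣ d₂) → kroneckerSymbol d₁ p = 1) ∧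
    (((p : ℤ) ∣ d₁ ∧ (p : ℤ) ∣ d₂) →
      kroneckerSymbol (primeToPart p d₁ * primeToPart p d₂) p = 1)) ∧
  (p = 2 →
    ((¬ 2 ∣ d₁ ∧ ¬ 2 ∣ d₂) → eta d₁ (d₂ + 2) = 1) ∧
    ((2 ∣ d₁ ∧ ¬ 2 ∣ d₂) → eta (primeToPart 2 d₁) (d₂ + 2) * kroneckerSymbol 2 d₂ = 1) ∧
    ((¬ 2 ∣ d₁ ∧ 2 ∣ d₂) → eta d₁ (primeToPart 2 d₂ + 2) * kroneckerSymbol 2 d₁ = 1) ∧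
    ((2 ∣ d₁ ∧ 2 ∣ d₂) → eta (primeToPart 2 d₁) (primeToPart 2 d₂ + 2) *
      kroneckerSymbol 2 (primeToPart 2 d₁ * primeToPart 2 d₂) = 1))

/-- The condition at the prime `p` in the case "cyclic over `ℚ(√(d₁d₂))`". -/
def localConditionProd (d₁ d₂ : ℤ) (p : ℕ) : Prop :=
  (2 < p →
    (((p : ℤ) ∣ d₁ ∧ ¬ (p : ℤ) ∣ d₂) → kroneckerSymbol d₂ p = 1) ∧
    ((¬ (p : ℤ) ∣ d₁ ∧ (p : ℤ) ∣ d₂) → kroneckerSymbol d₁ p = 1) ∧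
    (((p : ℤ) ∣ d₁ ∧ (p : ℤ) ∣ d₂) →
      kroneckerSymbol (-(primeToPart p d₁ * primeToPart p d₂)) p = 1)) ∧
  (p = 2 →
    ((¬ 2 ∣ d₁ ∧ ¬ 2 ∣ d₂) → eta d₁ d₂ = 1) ∧
    ((2 ∣ d₁ ∧ ¬ 2 ∣ d₂) → eta (primeToPart 2 d₁) d₂ * kroneckerSymbol 2 d₂ = 1) ∧
    ((¬ 2 ∣ d₁ ∧ 2 ∣ d₂) → eta d₁ (primeToPart 2 d₂) * kroneckerSymbol 2 d₁ = 1) ∧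
    ((2 ∣ d₁ ∧ 2 ∣ d₂) → eta (primeToPart 2 d₁) (primeToPart 2 d₂) *
      kroneckerSymbol 2 (primeToPart 2 d₁ * primeToPart 2 d₂) = 1))

/-! ### Sign conditions together with the local conditions at all primes -/

/-- All conditions of the case "cyclic over `ℚ(√d₁)`". -/
def conditionsFst (d₁ d₂ : ℤ) : Prop :=
  (d₁.sign, d₂.sign) ≠ (1, -1) ∧ ∀ p : ℕ, p.Prime → localConditionFst d₁ d₂ p

/-- All conditions of the case "cyclic over `ℚ(√d₂)`". -/
def conditionsSnd (d₁ d₂ : ℤ) : Prop :=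
  (d₁.sign, d₂.sign) ≠ (-1, 1) ∧ ∀ p : ℕ, p.Prime → localConditionSnd d₁ d₂ p

/-- All conditions of the case "cyclic over `ℚ(√(d₁d₂))`". -/
def conditionsProd (d₁ d₂ : ℤ) : Prop :=
  (d₁.sign, d₂.sign) ≠ (-1, -1) ∧ ∀ p : ℕ, p.Prime → localConditionProd d₁ d₂ p

/-! ### Hilbert symbols -/

open Classical in
/-- The Hilbert symbol `(a, b)` of a field `k`, for `a, b ≠ 0`: it is `1` if
`a x² + b y² = z²` has a solution `(x, y, z) ≠ (0, 0, 0)` in `k³`, and `-1` otherwise. -/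
noncomputable def hilbertSymbol (k : Type*) [Field k] (a b : k) : ℤ :=
  if ∃ x y z : k, (x, y, z) ≠ (0, 0, 0) ∧ a * x ^ 2 + b * y ^ 2 = z ^ 2 then 1 else -1

/-- The Hilbert symbol `(a, b)_∞` of two integers at the infinite place of `ℚ`. -/
noncomputable def hilbertInfinity (a b : ℤ) : ℤ :=
  hilbertSymbol ℝ (a : ℝ) (b : ℝ)

/-- The Hilbert symbol `(a, b)_p` of two integers at the finite place `p` of `ℚ`. -/
noncomputable def hilbertPrime (p : ℕ) [Fact p.Prime] (a b : ℤ) : ℤ :=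
  hilbertSymbol ℚ_[p] (a : ℚ_[p]) (b : ℚ_[p])

/-- `(a, b)_v = 1` at all places `v` of `ℚ`. -/
def HilbertTrivialEverywhere (a b : ℤ) : Prop :=
  hilbertInfinity a b = 1 ∧ ∀ (p : ℕ) [Fact p.Prime], hilbertPrime p a b = 1

/-! ### `D₄`-extensions inside a fixed algebraic closure -/

section Fields

variable {Ω : Type*} [Field Ω] [Algebra ℚ Ω]

/-- `F/ℚ` is Galois with Galois group isomorphic to the dihedral group `D₄` of order `8`. -/
def IsD4Extension (F : IntermediateField ℚ Ω) : Prop :=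
  IsGalois ℚ F ∧ Nonempty ((F ≃ₐ[ℚ] F) ≃* DihedralGroup 4)

/-- `F` is a cyclic (Galois) extension of its subfield `M`. -/
def IsCyclicOver (F M : IntermediateField ℚ Ω) : Prop :=
  ∃ h : M ≤ F, IsGalois M (IntermediateField.extendScalars h) ∧
    IsCyclic (IntermediateField.extendScalars h ≃ₐ[M] IntermediateField.extendScalars h)

/-- `K` is contained in a `D₄`-extension of `ℚ`. -/
def InD4Extension (K : IntermediateField ℚ Ω) : Prop :=
  ∃ F : IntermediateField ℚ Ω, IsD4Extension F ∧ K ≤ F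

/-- `K` is contained in a `D₄`-extension of `ℚ` that is cyclic over `M`. -/
def InD4ExtensionCyclicOver (K M : IntermediateField ℚ Ω) : Prop :=
  ∃ F : IntermediateField ℚ Ω, IsD4Extension F ∧ K ≤ F ∧ IsCyclicOver F M

end Fields

end BiquadraticD4

open scoped IntermediateField

namespace BiquadraticD4

/-! ### The quadratic form `a x² + b y² - z²` over a field -/

/-! Let `s² = a` and `t² = b`, with none of `a`, `b`, `ab` a rational square. The core fact is that
`ℚ(s, t)` lies in a `D₄`-extension cyclic over `ℚ(st)` exactly when `a x² + b y² = z²` has a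
nontrivial rational solution, i.e. when `u² - a v² = b w²` for some rationals not all zero
(`inD4ExtensionCyclicOver_iff`). Given a solution, put `θ = √(u + v s)` and `θ' = √(u - v s)` with
`θθ' = w t`; then `ℚ(θ, θ')` is the wanted extension (`exists_dihedral`). Conversely, a
`D₄`-extension contains some `θ ≠ 0` fixed by a reflection and negated by the central rotation, and
`θ²`, `(σθ)²`, `θ·σθ` give `u, v, w` (`isHilbertSolvable_of_reflection`).

The three quadratic subfields correspond to the pairs `(d₂, d₁d₂)`, `(d₁, d₁d₂)`, `(d₁, d₂)`,
because the product of the two roots is a rational multiple of `√d₁`, `√d₂`, `√(d₁d₂)` respectively.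
A rotation of order 4 fixes at least one of these roots, so every `D₄`-extension containing `K`
falls under one of the three cases.

Rational solvability is equivalent to local solvability everywhere, by Legendre's descent
(`isHilbertSolvable_of_isLocallySolvable`). The local symbols are computed by reduction and Hensel
lifting, which gives the third table (`localConditionProd_iff`). Since `(a, ab) = (a, -b)`, the
first two tables are the third one with the sign of `d₁` or of `d₂` changed. -/

/-- The equation `a x² + b y² = z²` has a non-trivial solution in `k`. -/
def IsHilbertSolvable (k : Type*) [Field k] (a b : k) : Prop :=
  ∃ x y z : k, (x, y, z) ≠ (0, 0, 0) ∧ a * x ^ 2 + b * y ^ 2 = z ^ 2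

theorem hilbertSymbol_eq_one_iff {k : Type*} [Field k] {a b : k} :
    hilbertSymbol k a b = 1 ↔ IsHilbertSolvable k a b := by
  unfold hilbertSymbol
  split_ifs with h
  · exact iff_of_true rfl h
  · exact iff_of_false (by decide) h

namespace IsHilbertSolvable

variable {k : Type*} [Field k] {a b c : k}

theorem symm (h : IsHilbertSolvable k a b) : IsHilbertSolvable k b a := by
  obtain ⟨x, y, z, h0, h⟩ := h
  refine ⟨y, x, z, fun h1 => h0 ?_, by rw [← h]; ring⟩
  simp only [Prod.mk.injEq] at h1 ⊢
  tauto

theorem comm : IsHilbertSolvable k a b ↔ IsHilbertSolvable k b a := ⟨symm, symm⟩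

theorem of_isSquare_left (h : IsSquare a) : IsHilbertSolvable k a b := by
  obtain ⟨r, rfl⟩ := h
  exact ⟨1, 0, r, by simp, by ring⟩

theorem of_isSquare_right (h : IsSquare b) : IsHilbertSolvable k a b :=
  (of_isSquare_left h).symm

/-- Multiplying the equation by `a` turns `a x` into the new square root and `z` into a new
variable. -/
theorem neg_mul (ha : a ≠ 0) (h : IsHilbertSolvable k a b) : IsHilbertSolvable k a (-(a * b)) := by
  obtain ⟨x, y, z, h0, h⟩ := h
  refine ⟨z, y, a * x, fun h1 => h0 ?_, by rw [← h]; ring⟩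
  simp only [Prod.mk.injEq, mul_eq_zero, ha, false_or] at h1 ⊢
  tauto

theorem map {l : Type*} [Field l] (f : k →+* l) (h : IsHilbertSolvable k a b) :
    IsHilbertSolvable l (f a) (f b) := by
  obtain ⟨x, y, z, h0, h⟩ := h
  refine ⟨f x, f y, f z, fun h1 => h0 ?_, by simpa using congrArg f h⟩
  simpa using h1

theorem mul_sq_right_iff (hc : c ≠ 0) :
    IsHilbertSolvable k a (c ^ 2 * b) ↔ IsHilbertSolvable k a b := by
  constructor
  · rintro ⟨x, y, z, h0, h⟩
    refine ⟨x, c * y, z, fun h1 => h0 ?_, by rw [← h]; ring⟩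
    simp only [Prod.mk.injEq, mul_eq_zero, hc, false_or] at h1 ⊢
    tauto
  · rintro ⟨x, y, z, h0, h⟩
    refine ⟨c * x, y, c * z, fun h1 => h0 ?_, by linear_combination c ^ 2 * h⟩
    simp only [Prod.mk.injEq, mul_eq_zero, hc, false_or] at h1 ⊢
    tauto

theorem neg_mul_iff (ha : a ≠ 0) :
    IsHilbertSolvable k a (-(a * b)) ↔ IsHilbertSolvable k a b := by
  refine ⟨fun h => ?_, neg_mul ha⟩
  have := h.neg_mul ha
  rwa [show -(a * -(a * b)) = a ^ 2 * b by ring, mul_sq_right_iff ha] at this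

/-- This trades the product `d₁d₂`, which need not be square-free, for a square-free entry with a
sign. -/
theorem mul_iff (ha : a ≠ 0) :
    IsHilbertSolvable k a (a * b) ↔ IsHilbertSolvable k a (-b) := by
  rw [← neg_mul_iff ha (b := -b), mul_neg, neg_neg]

/-- If `b c` is, up to a square, the norm `t² - a` of `t + √a`, then solvability for `(a, b)`
implies solvability for `(a, c)`. -/
theorem of_norm {t u : k} (hb : b ≠ 0) (hu : u ≠ 0) (ht : t ^ 2 ≠ a)
    (h : t ^ 2 - a = b * c * u ^ 2) (hab : IsHilbertSolvable k a b) :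
    IsHilbertSolvable k a c := by
  obtain ⟨x, y, z, h0, hxy⟩ := hab
  -- Coefficients of `(z + x√a)(t + √a)`: norms multiply, and `b y² · b c u² = c (b y u)²`.
  refine ⟨z + t * x, b * y * u, z * t + a * x, fun h1 => h0 ?_, ?_⟩
  · simp only [Prod.mk.injEq, mul_eq_zero, hb, hu, false_or, or_false] at h1 ⊢
    obtain ⟨h1, rfl, h2⟩ := h1
    have hx : x * (a - t ^ 2) = 0 := by linear_combination h2 - t * h1
    have hx : x = 0 := (mul_eq_zero.mp hx).resolve_right fun h => ht (sub_eq_zero.mp h).symm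
    subst hx
    simpa using h1
  · linear_combination (t ^ 2 - a) * hxy - b * y ^ 2 * h

end IsHilbertSolvable

theorem isHilbertSolvable_real_iff {a b : ℝ} (ha : a ≠ 0) (hb : b ≠ 0) :
    IsHilbertSolvable ℝ a b ↔ 0 < a ∨ 0 < b := by
  constructor
  · rintro ⟨x, y, z, h0, h⟩
    by_contra! hn
    have ha := lt_of_le_of_ne hn.1 ha
    have hb := lt_of_le_of_ne hn.2 hb
    have h1 : x ^ 2 = 0 := by nlinarith [sq_nonneg x, sq_nonneg y, sq_nonneg z]
    have h2 : y ^ 2 = 0 := by nlinarith [sq_nonneg x, sq_nonneg y, sq_nonneg z]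
    have h3 : z ^ 2 = 0 := by rw [← h, h1, h2]; ring
    exact h0 (by simp_all)
  · rintro (h | h)
    · exact .of_isSquare_left ⟨√a, (Real.mul_self_sqrt h.le).symm⟩
    · exact .of_isSquare_right ⟨√b, (Real.mul_self_sqrt h.le).symm⟩

/-! ### Squares in `ℤ_[p]` and primitive solutions -/

section Padic

variable {p : ℕ} [Fact p.Prime]

theorem isSquare_padicInt_of_norm_lt {u a : ℤ_[p]} (h : ‖a ^ 2 - u‖ < ‖2 * a‖ ^ 2) :
    IsSquare u := by
  obtain ⟨z, hz, -⟩ := hensels_lemma (p := p) (R := ℤ_[p])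
    (F := Polynomial.X ^ 2 - Polynomial.C u) (a := a)
    (by simpa [Polynomial.derivative_X_pow, one_add_one_eq_two] using h)
  exact ⟨z, by simp at hz; linear_combination -hz⟩

theorem isUnit_two_padicInt (hp : p ≠ 2) : IsUnit (2 : ℤ_[p]) := by
  rw [PadicInt.isUnit_iff]
  by_contra h
  have h1 : ‖((2 : ℤ) : ℤ_[p])‖ < 1 := lt_of_le_of_ne (PadicInt.norm_le_one _) (by simpa using h)
  rw [PadicInt.norm_int_lt_one_iff_dvd] at h1
  exact hp ((Nat.prime_dvd_prime_iff_eq Fact.out Nat.prime_two).mp (by exact_mod_cast h1))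

theorem toZMod_eq_zero_iff (x : ℤ_[p]) : PadicInt.toZMod x = 0 ↔ (p : ℤ_[p]) ∣ x := by
  rw [← PadicInt.norm_lt_one_iff_dvd, ← PadicInt.mem_nonunits, ← RingHom.mem_ker,
    PadicInt.ker_toZMod, IsLocalRing.mem_maximalIdeal]

theorem isSquare_padicInt_of_toZMod (hp : p ≠ 2) {u : ℤ_[p]} (h0 : PadicInt.toZMod u ≠ 0)
    (h : IsSquare (PadicInt.toZMod u)) : IsSquare u := by
  obtain ⟨r, hr⟩ := h
  obtain ⟨a, rfl⟩ := ZMod.ringHom_surjective (PadicInt.toZMod (p := p)) r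
  have ha : PadicInt.toZMod a ≠ 0 := fun h => h0 (by rw [hr, h, zero_mul])
  have ha1 : ‖a‖ = 1 := by
    refine le_antisymm (PadicInt.norm_le_one _) (not_lt.mp fun h => ha ?_)
    rwa [toZMod_eq_zero_iff, ← PadicInt.norm_lt_one_iff_dvd]
  refine isSquare_padicInt_of_norm_lt (a := a) ?_
  rw [norm_mul, PadicInt.isUnit_iff.mp (isUnit_two_padicInt hp), ha1, one_mul, one_pow,
    PadicInt.norm_lt_one_iff_dvd, ← toZMod_eq_zero_iff, map_sub, map_pow, hr]
  ring

theorem isSquare_padicInt_two {u : ℤ} (h : u % 8 = 1) : IsSquare (u : ℤ_[2]) := by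
  -- Hensel at `1` works because `|1 - u| ≤ 1/8 < 1/4 = |2|²`.
  refine isSquare_padicInt_of_norm_lt (a := 1) ?_
  have h8 : ((2 : ℕ) ^ 3 : ℤ) ∣ 1 - u := by norm_num; omega
  have h1 := (PadicInt.norm_int_le_pow_iff_dvd (p := 2) (k := 1 - u) (n := 3)).mpr (by exact_mod_cast h8)
  have h2 : ‖(2 : ℤ_[2])‖ = 2⁻¹ := by simpa using PadicInt.norm_p (p := 2)
  rw [mul_one, h2, one_pow]
  push_cast at h1
  refine lt_of_le_of_lt h1 ?_
  norm_num

theorem isSquare_padic_of_padicInt {u : ℤ} (h : IsSquare (u : ℤ_[p])) : IsSquare (u : ℚ_[p]) := by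
  simpa using h.map (PadicInt.Coe.ringHom (p := p))

/-- A solution over `ℚ_[p]` can be scaled to a primitive solution over `ℤ_[p]`. -/
theorem IsHilbertSolvable.exists_primitive {a b : ℤ}
    (h : IsHilbertSolvable ℚ_[p] (a : ℚ_[p]) (b : ℚ_[p])) :
    ∃ x y z : ℤ_[p], ¬ ((p : ℤ_[p]) ∣ x ∧ (p : ℤ_[p]) ∣ y ∧ (p : ℤ_[p]) ∣ z) ∧
      (a : ℤ_[p]) * x ^ 2 + (b : ℤ_[p]) * y ^ 2 = z ^ 2 := by
  obtain ⟨x, y, z, h0, h⟩ := h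
  -- Dividing by a coordinate of maximal norm makes all three integral and one of them equal to `1`.
  obtain ⟨m, hm, hmx, hmy, hmz⟩ : ∃ m : ℚ_[p], (m = x ∨ m = y ∨ m = z) ∧
      ‖x‖ ≤ ‖m‖ ∧ ‖y‖ ≤ ‖m‖ ∧ ‖z‖ ≤ ‖m‖ := by
    rcases le_total ‖x‖ ‖y‖ with h1 | h1 <;> rcases le_total ‖y‖ ‖z‖ with h2 | h2 <;>
      rcases le_total ‖x‖ ‖z‖ with h3 | h3
    · exact ⟨z, by simp [h2, h3]⟩
    · exact ⟨z, by simp [h2, h1.trans h2]⟩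
    · exact ⟨y, by simp [h1, h2]⟩
    · exact ⟨y, by simp [h1, h2]⟩
    · exact ⟨z, by simp [h2, h3]⟩
    · exact ⟨x, by simp [h1, h3]⟩
    · exact ⟨z, by simp [h3, h1.trans h3]⟩
    · exact ⟨x, by simp [h1, h3]⟩
  have hm0 : m ≠ 0 := by
    rintro rfl
    simp only [norm_zero, norm_le_zero_iff] at hmx hmy hmz
    exact h0 (by simp [hmx, hmy, hmz])
  have key : ∀ t : ℚ_[p], ‖t‖ ≤ ‖m‖ → ∃ w : ℤ_[p], (w : ℚ_[p]) = t / m := fun t ht =>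
    ⟨⟨t / m, by rw [norm_div]; exact div_le_one_of_le₀ ht (norm_nonneg _)⟩, rfl⟩
  obtain ⟨x', hx⟩ := key x hmx
  obtain ⟨y', hy⟩ := key y hmy
  obtain ⟨z', hz⟩ := key z hmz
  refine ⟨x', y', z', ?_, ?_⟩
  · simp only [← PadicInt.norm_lt_one_iff_dvd, PadicInt.norm_def, hx, hy, hz]
    have h1 : ‖m / m‖ = 1 := by rw [div_self hm0, norm_one]
    rcases hm with rfl | rfl | rfl <;> simp [h1]
  · apply PadicInt.ext
    push_cast
    rw [hx, hy, hz]
    field_simp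
    exact h

end Padic

/-! ### Local solvability at odd primes -/

section Padic

variable {p : ℕ} [Fact p.Prime]

theorem toZMod_intCast_eq_zero_iff (u : ℤ) :
    PadicInt.toZMod (u : ℤ_[p]) = 0 ↔ (p : ℤ) ∣ u := by
  rw [map_intCast, ZMod.intCast_zmod_eq_zero_iff_dvd]

/-- The coefficient `p v` has exactly one factor `p`: if `p ∣ x`, then `p ∣ z`, hence `p² ∣ p v y²`
and `p ∣ y`, against primitivity. -/
theorem not_dvd_of_primitive {u v : ℤ} (hv : ¬ (p : ℤ) ∣ v) {x y z : ℤ_[p]}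
    (h0 : ¬ ((p : ℤ_[p]) ∣ x ∧ (p : ℤ_[p]) ∣ y ∧ (p : ℤ_[p]) ∣ z))
    (h : (u : ℤ_[p]) * x ^ 2 + ((p * v : ℤ) : ℤ_[p]) * y ^ 2 = z ^ 2) : ¬ (p : ℤ_[p]) ∣ x := by
  rintro ⟨x', rfl⟩
  have hp : Prime (p : ℤ_[p]) := PadicInt.prime_p
  push_cast at h
  obtain ⟨z', rfl⟩ : (p : ℤ_[p]) ∣ z :=
    hp.dvd_of_dvd_pow (n := 2) ⟨u * p * x' ^ 2 + v * y ^ 2, by rw [← h]; ring⟩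
  have h1 : (p : ℤ_[p]) ∣ v * y ^ 2 :=
    ⟨z' ^ 2 - u * x' ^ 2, mul_left_cancel₀ hp.ne_zero (by linear_combination h)⟩
  rcases hp.dvd_or_dvd h1 with h1 | h1
  · exact hv (by rwa [← toZMod_eq_zero_iff, toZMod_intCast_eq_zero_iff] at h1)
  · exact h0 ⟨dvd_mul_right _ _, hp.dvd_of_dvd_pow h1, dvd_mul_right _ _⟩

/-- Modulo `p` the `y`-term vanishes and `x` is invertible, so `u = (z/x)²`. The case `p = 2` is
included, as the global descent needs it. -/
theorem IsHilbertSolvable.isSquare_zmod {u v : ℤ} (hv : ¬ (p : ℤ) ∣ v)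
    (h : IsHilbertSolvable ℚ_[p] (u : ℚ_[p]) ((p * v : ℤ) : ℚ_[p])) : IsSquare (u : ZMod p) := by
  obtain ⟨x, y, z, h0, h⟩ := h.exists_primitive
  have hx := not_dvd_of_primitive hv h0 h
  rw [← toZMod_eq_zero_iff] at hx
  have := congrArg (PadicInt.toZMod (p := p)) h
  simp only [map_add, map_mul, map_intCast, map_pow, Int.cast_mul, Int.cast_natCast,
    map_natCast, CharP.cast_eq_zero, zero_mul, add_zero] at this
  exact ⟨PadicInt.toZMod z / PadicInt.toZMod x, by field_simp; exact this⟩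

theorem isHilbertSolvable_padic_unit_mul_iff (hp : p ≠ 2) {u v : ℤ} (hu : ¬ (p : ℤ) ∣ u)
    (hv : ¬ (p : ℤ) ∣ v) :
    IsHilbertSolvable ℚ_[p] (u : ℚ_[p]) ((p * v : ℤ) : ℚ_[p]) ↔ IsSquare (u : ZMod p) := by
  refine ⟨fun h => h.isSquare_zmod hv, fun h => .of_isSquare_left ?_⟩
  refine isSquare_padic_of_padicInt (isSquare_padicInt_of_toZMod hp ?_ (by rwa [map_intCast]))
  rwa [Ne, toZMod_intCast_eq_zero_iff]

theorem exists_sq_add_sq_eq_one (hp : p ≠ 2) {u v : ZMod p} (hu : u ≠ 0) (hv : v ≠ 0) :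
    ∃ x y : ZMod p, u * x ^ 2 + v * y ^ 2 = 1 := by
  open Polynomial in
  obtain ⟨x, y, h⟩ := FiniteField.exists_root_sum_quadratic (R := ZMod p)
    (f := C u * X ^ 2 + C 0 * X + C (-1)) (g := C v * X ^ 2 + C 0 * X + C 0)
    (degree_quadratic hu) (degree_quadratic hv) (by
      rw [ZMod.card]; exact Nat.odd_iff.mp ((Fact.out : p.Prime).odd_of_ne_two hp))
  refine ⟨x, y, ?_⟩
  simp at h
  linear_combination h

/-- A solution of `u x² + v y² = 1` modulo `p` exists by counting; for any integer lifts of `x, y`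
the value is `1` modulo `p`, hence a `p`-adic square. -/
theorem isHilbertSolvable_padic_of_units (hp : p ≠ 2) {u v : ℤ} (hu : ¬ (p : ℤ) ∣ u)
    (hv : ¬ (p : ℤ) ∣ v) : IsHilbertSolvable ℚ_[p] (u : ℚ_[p]) (v : ℚ_[p]) := by
  obtain ⟨x, y, h⟩ := exists_sq_add_sq_eq_one hp (u := (u : ZMod p)) (v := (v : ZMod p))
    (by rwa [Ne, ZMod.intCast_zmod_eq_zero_iff_dvd])
    (by rwa [Ne, ZMod.intCast_zmod_eq_zero_iff_dvd])
  obtain ⟨x, rfl⟩ := ZMod.intCast_surjective x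
  obtain ⟨y, rfl⟩ := ZMod.intCast_surjective y
  have h1 : PadicInt.toZMod ((u * x ^ 2 + v * y ^ 2 : ℤ) : ℤ_[p]) = 1 := by
    rw [map_intCast]; exact_mod_cast h
  obtain ⟨z, hz⟩ := isSquare_padic_of_padicInt
    (isSquare_padicInt_of_toZMod hp (by rw [h1]; exact one_ne_zero) (by rw [h1]; exact .one))
  refine ⟨x, y, z, fun h0 => ?_, by push_cast at hz; rw [hz]; ring⟩
  simp only [Prod.mk.injEq, Int.cast_eq_zero] at h0
  simp [h0] at h1

/-- `(pu, pv) = (pu, -p²uv) = (pu, -uv)`, so two entries divisible by `p` reduce to one. This is the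
origin of the product in the last row of the tables. -/
theorem isHilbertSolvable_padic_mul_mul_iff {u v : ℤ} (hu : u ≠ 0) :
    IsHilbertSolvable ℚ_[p] ((p * u : ℤ) : ℚ_[p]) ((p * v : ℤ) : ℚ_[p]) ↔
      IsHilbertSolvable ℚ_[p] ((-(u * v) : ℤ) : ℚ_[p]) ((p * u : ℤ) : ℚ_[p]) := by
  have hp : (p : ℚ_[p]) ≠ 0 := by exact_mod_cast (Fact.out : p.Prime).ne_zero
  have hu : (u : ℚ_[p]) ≠ 0 := by exact_mod_cast hu
  rw [← IsHilbertSolvable.neg_mul_iff (by push_cast; exact mul_ne_zero hp hu),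
    IsHilbertSolvable.comm (b := ((p * u : ℤ) : ℚ_[p])),
    ← IsHilbertSolvable.mul_sq_right_iff hp (b := ((-(u * v) : ℤ) : ℚ_[p]))]
  push_cast
  ring_nf

theorem not_dvd_neg_mul {u v : ℤ} (hu : ¬ (p : ℤ) ∣ u) (hv : ¬ (p : ℤ) ∣ v) :
    ¬ (p : ℤ) ∣ -(u * v) := by
  have hp := Nat.prime_iff_prime_int.mp (Fact.out : p.Prime)
  rw [dvd_neg, hp.dvd_mul]
  tauto

end Padic

/-! ### Local solvability at `2` -/

theorem padicInt_two_even_or_odd (x : ℤ_[2]) : (2 : ℤ_[2]) ∣ x ∨ ∃ t, x = 1 + 2 * t := by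
  have h2 : ∀ c : ZMod 2, c = 0 ∨ c = 1 := by decide
  rcases h2 (PadicInt.toZMod x) with h | h
  · exact .inl (by simpa using (toZMod_eq_zero_iff x).mp h)
  · obtain ⟨t, ht⟩ := (toZMod_eq_zero_iff (x - 1)).mp (by rw [map_sub, map_one, h, sub_self])
    exact .inr ⟨t, by push_cast at ht; linear_combination ht⟩

theorem zmod_eight_sq_odd : ∀ t : ZMod (2 ^ 3), (1 + 2 * t) ^ 2 = 1 := by decide

theorem zmod_eight_two_mul_sq : ∀ t : ZMod (2 ^ 3), 2 * t ^ 2 = 0 ∨ 2 * t ^ 2 = 2 := by decide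

theorem zmod_four_sq_odd : ∀ t : ZMod (2 ^ 2), (1 + 2 * t) ^ 2 = 1 := by decide

theorem zmod_four_sq_even : ∀ t : ZMod (2 ^ 2), (2 * t) ^ 2 = 0 := by decide

/-- In a primitive solution `x` and `z` are odd, with squares `1` modulo `8`, while `2y²` is `0` or
`2`; the two values give the two alternatives. Conversely, `y = 0` or `x = y = 1` makes the left
side a 2-adic square. -/
theorem isHilbertSolvable_padic_two_unit_mul_iff {u v : ℤ} (hu : u % 2 = 1) (hv : v % 2 = 1) :
    IsHilbertSolvable ℚ_[2] (u : ℚ_[2]) ((2 * v : ℤ) : ℚ_[2]) ↔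
      u % 8 = 1 ∨ (u + 2 * v) % 8 = 1 := by
  constructor
  · intro h
    obtain ⟨x, y, z, h0, h⟩ := h.exists_primitive
    have hx := not_dvd_of_primitive (p := 2) (u := u) (v := v) (by push_cast; omega) h0 (by exact_mod_cast h)
    obtain ⟨x, rfl⟩ := (padicInt_two_even_or_odd x).resolve_left (by exact_mod_cast hx)
    obtain ⟨z, rfl⟩ : ∃ t, z = 1 + 2 * t := by
      refine (padicInt_two_even_or_odd z).resolve_left ?_
      rintro ⟨t, rfl⟩
      have h2 : ((2 : ℕ) : ℤ_[2]) ∣ (u : ℤ_[2]) :=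
        ⟨2 * t ^ 2 - v * y ^ 2 - u * (2 * x + 2 * x ^ 2), by
          push_cast at h ⊢; linear_combination h⟩
      rw [← toZMod_eq_zero_iff, toZMod_intCast_eq_zero_iff] at h2
      push_cast at h2
      omega
    have h := congrArg (PadicInt.toZModPow (p := 2) 3) h
    simp only [map_add, map_mul, map_pow, map_intCast, map_one, map_ofNat, zmod_eight_sq_odd,
      mul_one, Int.cast_mul, Int.cast_ofNat] at h
    rw [mul_right_comm, mul_comm _ (v : ZMod (2 ^ 3))] at h
    rcases zmod_eight_two_mul_sq (PadicInt.toZModPow 3 y) with h1 | h1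
    · rw [h1] at h
      have : ((u - 1 : ℤ) : ZMod (2 ^ 3)) = 0 := by push_cast; linear_combination h
      rw [ZMod.intCast_zmod_eq_zero_iff_dvd] at this
      push_cast at this
      omega
    · rw [h1] at h
      have : ((u + 2 * v - 1 : ℤ) : ZMod (2 ^ 3)) = 0 := by push_cast; linear_combination h
      rw [ZMod.intCast_zmod_eq_zero_iff_dvd] at this
      push_cast at this
      omega
  · rintro (h | h)
    · exact .of_isSquare_left (isSquare_padic_of_padicInt (isSquare_padicInt_two h))
    · obtain ⟨z, hz⟩ := isSquare_padic_of_padicInt (isSquare_padicInt_two h)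
      refine ⟨1, 1, z, by simp, ?_⟩
      push_cast at hz ⊢
      linear_combination hz

/-- Either `u` is a 2-adic square, or `u ≡ 5` modulo `8` and `u + 4v` is one, as `v` is odd. -/
theorem isHilbertSolvable_padic_two_of_mod_four {u v : ℤ} (hu : u % 4 = 1) (hv : v % 2 = 1) :
    IsHilbertSolvable ℚ_[2] (u : ℚ_[2]) (v : ℚ_[2]) := by
  obtain h | h : u % 8 = 1 ∨ (u + 4 * v) % 8 = 1 := by omega
  · exact .of_isSquare_left (isSquare_padic_of_padicInt (isSquare_padicInt_two h))
  · obtain ⟨z, hz⟩ := isSquare_padic_of_padicInt (isSquare_padicInt_two h)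
    refine ⟨1, 2, z, by simp, ?_⟩
    push_cast at hz ⊢
    linear_combination hz

/-- If both units are `3` modulo `4`, then `3x² + 3y² = z²` modulo `4` forces `x, y, z` all even. -/
theorem isHilbertSolvable_padic_two_units_iff {u v : ℤ} (hu : u % 2 = 1) (hv : v % 2 = 1) :
    IsHilbertSolvable ℚ_[2] (u : ℚ_[2]) (v : ℚ_[2]) ↔ u % 4 = 1 ∨ v % 4 = 1 := by
  refine ⟨fun h => ?_, ?_⟩
  · by_contra hn
    obtain ⟨x, y, z, h0, h⟩ := h.exists_primitive
    have h := congrArg (PadicInt.toZModPow (p := 2) 2) h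
    have h3 : ∀ w : ℤ, w % 2 = 1 → ¬ w % 4 = 1 → (w : ZMod (2 ^ 2)) = 3 := fun w _ _ => by
      rw [← sub_eq_zero, show (w : ZMod (2 ^ 2)) - 3 = ((w - 3 : ℤ) : ZMod (2 ^ 2)) by push_cast; rfl,
        ZMod.intCast_zmod_eq_zero_iff_dvd]
      push_cast
      omega
    simp only [map_add, map_mul, map_pow, map_intCast, h3 u hu (by tauto), h3 v hv (by tauto)] at h
    push_cast at h0
    rcases padicInt_two_even_or_odd x with ⟨x, rfl⟩ | ⟨x, rfl⟩ <;>
    rcases padicInt_two_even_or_odd y with ⟨y, rfl⟩ | ⟨y, rfl⟩ <;>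
    rcases padicInt_two_even_or_odd z with ⟨z, rfl⟩ | ⟨z, rfl⟩ <;>
    simp only [map_add, map_mul, map_one, map_ofNat, zmod_four_sq_odd, zmod_four_sq_even] at h
    · exact h0 ⟨dvd_mul_right _ _, dvd_mul_right _ _, dvd_mul_right _ _⟩
    all_goals exact absurd h (by decide)
  · rintro (h | h)
    · exact isHilbertSolvable_padic_two_of_mod_four h hv
    · exact (isHilbertSolvable_padic_two_of_mod_four h hu).symm

/-! ### The symbols occurring in the tables -/

theorem eta_eq_ite {a b : ℤ} (ha : a % 2 = 1) (hb : b % 2 = 1) :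
    eta a b = if a % 4 = 1 ∨ b % 4 = 1 then 1 else -1 := by
  unfold eta
  split_ifs with h
  · rw [Int.negOnePow_even _ (by
      rw [Int.even_mul]; rcases h with h | h
      · exact .inl (by rw [Int.even_iff]; omega)
      · exact .inr (by rw [Int.even_iff]; omega))]
    rfl
  · rw [Int.negOnePow_odd _ (by
      rw [Int.odd_mul, Int.odd_iff, Int.odd_iff]; omega)]
    rfl

theorem kroneckerSymbol_two_left {n : ℤ} (hn : n % 2 = 1) :
    kroneckerSymbol 2 n = if n % 8 = 1 ∨ n % 8 = 7 then 1 else -1 := by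
  have h0 : n ≠ 0 := by omega
  have hv : padicValNat 2 n.natAbs = 0 := padicValNat.eq_zero_of_not_dvd (by omega)
  have h2 : ¬ (n < 0 ∧ (2 : ℤ) < 0) := by omega
  rw [kroneckerSymbol, if_neg h0, if_neg h2, hv, pow_zero, pow_zero, Nat.div_one, one_mul, one_mul,
    jacobiSym.at_two (by rw [Nat.odd_iff]; omega), ZMod.χ₈_nat_eq_if_mod_eight]
  split_ifs <;> omega

theorem kroneckerSymbol_prime_eq_one_iff {p : ℕ} [Fact p.Prime] (hp : p ≠ 2) {u : ℤ}
    (hu : ¬ (p : ℤ) ∣ u) : kroneckerSymbol u p = 1 ↔ IsSquare (u : ZMod p) := by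
  have h0 : (p : ℤ) ≠ 0 := by exact_mod_cast (Fact.out : p.Prime).ne_zero
  have hv : padicValNat 2 (p : ℤ).natAbs = 0 := padicValNat.eq_zero_of_not_dvd (by
    rw [Int.natAbs_natCast, Nat.prime_dvd_prime_iff_eq Nat.prime_two Fact.out]; exact hp.symm)
  have h2 : ¬ ((p : ℤ) < 0 ∧ u < 0) := by omega
  rw [kroneckerSymbol, if_neg h0, if_neg h2, hv, pow_zero, pow_zero, Nat.div_one, one_mul, one_mul,
    Int.natAbs_natCast, ← jacobiSym.legendreSym.to_jacobiSym, legendreSym.eq_one_iff]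
  rwa [Ne, ZMod.intCast_zmod_eq_zero_iff_dvd]

theorem primeToPart_mul {p : ℕ} [Fact p.Prime] {u : ℤ} (hu : ¬ (p : ℤ) ∣ u) :
    primeToPart p (p * u) = u := by
  have hp : (p : ℤ) ≠ 0 := by exact_mod_cast (Fact.out : p.Prime).ne_zero
  have hu0 : u ≠ 0 := by rintro rfl; simp at hu
  rw [primeToPart, padicValInt.mul hp hu0, padicValInt.self (Fact.out : p.Prime).one_lt,
    padicValInt.eq_zero_of_not_dvd hu, add_zero, pow_one, Int.mul_ediv_cancel_left _ hp]

theorem _root_.Squarefree.exists_eq_prime_mul {p : ℕ} [Fact p.Prime] {a : ℤ} (ha : Squarefree a)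
    (h : (p : ℤ) ∣ a) : ∃ u, a = p * u ∧ ¬ (p : ℤ) ∣ u := by
  obtain ⟨u, rfl⟩ := h
  refine ⟨u, rfl, ?_⟩
  rintro ⟨w, rfl⟩
  exact (Nat.prime_iff_prime_int.mp (Fact.out : p.Prime)).not_isUnit
    (ha p ⟨w, by ring⟩)

/-- Square-freeness leaves only valuations `0` and `1`, so the four rows exhaust the cases. -/
theorem localConditionProd_iff_of_ne_two {p : ℕ} [Fact p.Prime] (hp : p ≠ 2) {a b : ℤ}
    (ha : Squarefree a) (hb : Squarefree b) :
    localConditionProd a b p ↔ IsHilbertSolvable ℚ_[p] (a : ℚ_[p]) (b : ℚ_[p]) := by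
  have h2 : 2 < p := lt_of_le_of_ne (Fact.out : p.Prime).two_le hp.symm
  simp only [localConditionProd, h2, hp, forall_true_left, false_imp_iff, and_true]
  by_cases hpa : (p : ℤ) ∣ a <;> by_cases hpb : (p : ℤ) ∣ b <;>
    simp only [hpa, hpb, not_true_eq_false, not_false_eq_true, and_true, true_and, and_false,
      false_imp_iff, forall_true_left]
  · obtain ⟨u, rfl, hu⟩ := ha.exists_eq_prime_mul hpa
    obtain ⟨v, rfl, hv⟩ := hb.exists_eq_prime_mul hpb
    rw [primeToPart_mul hu, primeToPart_mul hv,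
      kroneckerSymbol_prime_eq_one_iff hp (not_dvd_neg_mul hu hv),
      isHilbertSolvable_padic_mul_mul_iff (by rintro rfl; simp at hu),
      isHilbertSolvable_padic_unit_mul_iff hp (not_dvd_neg_mul hu hv) hu]
  · obtain ⟨u, rfl, hu⟩ := ha.exists_eq_prime_mul hpa
    rw [kroneckerSymbol_prime_eq_one_iff hp hpb, IsHilbertSolvable.comm,
      isHilbertSolvable_padic_unit_mul_iff hp hpb hu]
  · obtain ⟨v, rfl, hv⟩ := hb.exists_eq_prime_mul hpb
    rw [kroneckerSymbol_prime_eq_one_iff hp hpa,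
      isHilbertSolvable_padic_unit_mul_iff hp hpa hv]
  · exact iff_of_true trivial (isHilbertSolvable_padic_of_units hp hpa hpb)

/-- The right side is the criterion for the symbol `(u, 2v)` over `ℚ_[2]`. -/
theorem eta_mul_kroneckerSymbol_eq_one_iff {u v : ℤ} (hu : u % 2 = 1) (hv : v % 2 = 1) :
    eta u v * kroneckerSymbol 2 u = 1 ↔ u % 8 = 1 ∨ (u + 2 * v) % 8 = 1 := by
  rw [eta_eq_ite hu hv, kroneckerSymbol_two_left hu]
  split_ifs <;> norm_num <;> omega

theorem eta_comm (a b : ℤ) : eta a b = eta b a := by rw [eta, eta, mul_comm]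

/-- The right side is the criterion for `(-uv, 2u)`, to which `(2u, 2v)` has been reduced.
Everything depends on `u, v` modulo `8` only. -/
theorem eta_mul_kroneckerSymbol_mul_eq_one_iff {u v : ℤ} (hu : u % 2 = 1) (hv : v % 2 = 1) :
    eta u v * kroneckerSymbol 2 (u * v) = 1 ↔
      -(u * v) % 8 = 1 ∨ (-(u * v) + 2 * u) % 8 = 1 := by
  have h1 := Int.mul_emod u v 8
  rw [eta_eq_ite hu hv, kroneckerSymbol_two_left (by simp [Int.mul_emod, hu, hv])]
  obtain hu' | hu' | hu' | hu' : u % 8 = 1 ∨ u % 8 = 3 ∨ u % 8 = 5 ∨ u % 8 = 7 := by omega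
  all_goals
    obtain hv' | hv' | hv' | hv' : v % 8 = 1 ∨ v % 8 = 3 ∨ v % 8 = 5 ∨ v % 8 = 7 := by omega
    all_goals
      rw [hu', hv'] at h1
      norm_num at h1
      generalize u * v = w at h1 ⊢
      split_ifs <;> norm_num <;> omega

theorem localConditionProd_two_iff {a b : ℤ} (ha : Squarefree a) (hb : Squarefree b) :
    localConditionProd a b 2 ↔ IsHilbertSolvable ℚ_[2] (a : ℚ_[2]) (b : ℚ_[2]) := by
  simp only [localConditionProd, lt_irrefl, false_imp_iff, true_and, forall_true_left]
  by_cases hpa : (2 : ℤ) ∣ a <;> by_cases hpb : (2 : ℤ) ∣ b <;>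
    simp only [hpa, hpb, not_true_eq_false, not_false_eq_true, and_true, true_and, and_false,
      false_imp_iff, forall_true_left]
  · obtain ⟨u, rfl, hu⟩ := ha.exists_eq_prime_mul (p := 2) hpa
    obtain ⟨v, rfl, hv⟩ := hb.exists_eq_prime_mul (p := 2) hpb
    rw [primeToPart_mul hu, primeToPart_mul hv,
      isHilbertSolvable_padic_mul_mul_iff (by rintro rfl; simp at hu)]
    push_cast at hu hv
    rw [eta_mul_kroneckerSymbol_mul_eq_one_iff (by omega) (by omega)]
    have huv : -(u * v) % 2 = 1 := by
      have := not_dvd_neg_mul (p := 2) hu hv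
      push_cast at this
      omega
    exact (isHilbertSolvable_padic_two_unit_mul_iff huv (by omega)).symm
  · obtain ⟨u, rfl, hu⟩ := ha.exists_eq_prime_mul (p := 2) hpa
    rw [primeToPart_mul hu]
    push_cast at hu
    rw [eta_comm, eta_mul_kroneckerSymbol_eq_one_iff (by omega) (by omega), IsHilbertSolvable.comm]
    exact (isHilbertSolvable_padic_two_unit_mul_iff (by omega) (by omega)).symm
  · obtain ⟨v, rfl, hv⟩ := hb.exists_eq_prime_mul (p := 2) hpb
    rw [primeToPart_mul hv]
    push_cast at hv
    rw [eta_mul_kroneckerSymbol_eq_one_iff (by omega) (by omega)]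
    exact (isHilbertSolvable_padic_two_unit_mul_iff (by omega) (by omega)).symm
  · rw [isHilbertSolvable_padic_two_units_iff (by omega) (by omega),
      eta_eq_ite (by omega) (by omega)]
    split_ifs with h <;> simp [h]

theorem localConditionProd_iff {p : ℕ} [hp : Fact p.Prime] {a b : ℤ}
    (ha : Squarefree a) (hb : Squarefree b) :
    localConditionProd a b p ↔ IsHilbertSolvable ℚ_[p] (a : ℚ_[p]) (b : ℚ_[p]) := by
  by_cases h : p = 2
  · subst h
    convert localConditionProd_two_iff ha hb
  · exact localConditionProd_iff_of_ne_two h ha hb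

/-! ### Reduction of the first two tables to the third by a change of sign. -/

theorem primeToPart_neg (p : ℕ) [Fact p.Prime] {a : ℤ} (ha : Squarefree a) :
    primeToPart p (-a) = -primeToPart p a := by
  by_cases h : (p : ℤ) ∣ a
  · obtain ⟨u, rfl, hu⟩ := ha.exists_eq_prime_mul h
    rw [← mul_neg, primeToPart_mul hu, primeToPart_mul (by rwa [dvd_neg])]
  · have h' : ¬ (p : ℤ) ∣ -a := by rwa [dvd_neg]
    simp [primeToPart, padicValInt.eq_zero_of_not_dvd h, padicValInt.eq_zero_of_not_dvd h']

/-- For odd `a`, `-a ≡ a + 2` modulo `4`; this explains the shifts by `2` in the tables. -/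
theorem eta_neg_left {a b : ℤ} (ha : a % 2 = 1) (hb : b % 2 = 1) : eta (-a) b = eta (a + 2) b := by
  rw [eta_eq_ite (by omega) hb, eta_eq_ite (by omega) hb]
  split_ifs <;> omega

theorem kroneckerSymbol_two_neg {n : ℤ} (hn : n % 2 = 1) :
    kroneckerSymbol 2 (-n) = kroneckerSymbol 2 n := by
  rw [kroneckerSymbol_two_left (by omega), kroneckerSymbol_two_left hn]
  split_ifs <;> omega

theorem primeToPart_two_odd {a : ℤ} (ha : Squarefree a) : primeToPart 2 a % 2 = 1 := by
  by_cases h : (2 : ℤ) ∣ a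
  · obtain ⟨u, rfl, hu⟩ := ha.exists_eq_prime_mul (p := 2) h
    rw [primeToPart_mul hu]
    push_cast at hu
    omega
  · have := padicValInt.eq_zero_of_not_dvd (p := 2) (z := a) h
    rw [primeToPart, this, pow_zero, Int.ediv_one]
    omega

theorem localConditionFst_iff_prod {p : ℕ} [hp : Fact p.Prime] {a b : ℤ}
    (ha : Squarefree a) (hb : Squarefree b) :
    localConditionFst a b p ↔ localConditionProd (-a) b p := by
  have h1 := primeToPart_two_odd ha
  have h2 := primeToPart_two_odd hb
  have h3 : (primeToPart 2 a * primeToPart 2 b) % 2 = 1 := by simp [Int.mul_emod, h1, h2]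
  simp only [localConditionFst, localConditionProd, dvd_neg, primeToPart_neg _ ha, neg_mul, neg_neg]
  refine and_congr Iff.rfl (forall_congr' fun h => ?_)
  refine and_congr (forall_congr' fun h => ?_) (and_congr (forall_congr' fun h => ?_)
    (and_congr (forall_congr' fun h => ?_) (forall_congr' fun h => ?_)))
  · rw [eta_neg_left (by omega) (by omega)]
  · rw [eta_neg_left h1 (by omega)]
  · rw [eta_neg_left (by omega) h2, kroneckerSymbol_two_neg (by omega)]
  · rw [eta_neg_left h1 h2, kroneckerSymbol_two_neg h3]

theorem localConditionSnd_iff_prod {p : ℕ} [hp : Fact p.Prime] {a b : ℤ}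
    (ha : Squarefree a) (hb : Squarefree b) :
    localConditionSnd a b p ↔ localConditionProd a (-b) p := by
  have h1 := primeToPart_two_odd ha
  have h2 := primeToPart_two_odd hb
  have h3 : (primeToPart 2 a * primeToPart 2 b) % 2 = 1 := by simp [Int.mul_emod, h1, h2]
  simp only [localConditionSnd, localConditionProd, dvd_neg, primeToPart_neg _ hb, mul_neg, neg_neg]
  refine and_congr Iff.rfl (forall_congr' fun h => ?_)
  refine and_congr (forall_congr' fun h => ?_) (and_congr (forall_congr' fun h => ?_)
    (and_congr (forall_congr' fun h => ?_) (forall_congr' fun h => ?_)))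
  · rw [eta_comm _ (-b), eta_neg_left (by omega) (by omega), eta_comm]
  · rw [eta_comm _ (-b), eta_neg_left (by omega) h1, eta_comm, kroneckerSymbol_two_neg (by omega)]
  · rw [eta_comm _ (-_), eta_neg_left h2 (by omega), eta_comm]
  · rw [eta_comm _ (-_), eta_neg_left h2 h1, eta_comm, kroneckerSymbol_two_neg h3]

/-! ### The Hasse principle for `a x² + b y² = z²` -/

/-- Square roots modulo the distinct prime factors are glued by the Chinese remainder theorem. -/
theorem isSquare_zmod_of_squarefree (a : ℤ) (n : ℕ) (hn : Squarefree n)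
    (h : ∀ p : ℕ, p.Prime → p ∣ n → IsSquare (a : ZMod p)) : IsSquare (a : ZMod n) := by
  induction n using induction_on_primes with
  | zero => exact absurd hn not_squarefree_zero
  | one => exact ⟨0, Subsingleton.elim _ _⟩
  | prime_mul p n hp ih =>
    have hc : p.Coprime n := Nat.coprime_of_squarefree_mul hn
    have h1 := h p hp (dvd_mul_right _ _)
    have h2 := ih hn.of_mul_right fun q hq hqn => h q hq (hqn.mul_left _)
    obtain ⟨r, hr⟩ := h1
    obtain ⟨s, hs⟩ := h2
    let e := ZMod.chineseRemainder hc
    refine ⟨e.symm (r, s), e.injective ?_⟩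
    rw [map_mul, RingEquiv.apply_symm_apply, map_intCast, Prod.mk_mul_mk, ← hr, ← hs]
    rfl

/-- `(a, b)` is solvable over `ℝ` and over all `ℚ_[p]`. -/
def IsLocallySolvable (a b : ℤ) : Prop :=
  IsHilbertSolvable ℝ (a : ℝ) (b : ℝ) ∧
    ∀ (p : ℕ) [Fact p.Prime], IsHilbertSolvable ℚ_[p] (a : ℚ_[p]) (b : ℚ_[p])

theorem IsLocallySolvable.symm {a b : ℤ} (h : IsLocallySolvable a b) : IsLocallySolvable b a :=
  ⟨h.1.symm, fun p _ => (h.2 p).symm⟩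

theorem IsLocallySolvable.isSquare_zmod {a b : ℤ} (hb : Squarefree b)
    (h : IsLocallySolvable a b) : IsSquare (a : ZMod b.natAbs) := by
  refine isSquare_zmod_of_squarefree a _ (Int.squarefree_natAbs.mpr hb) fun p hp hpb => ?_
  have := Fact.mk hp
  obtain ⟨v, rfl, hv⟩ := hb.exists_eq_prime_mul (p := p) (Int.natCast_dvd.mpr hpb)
  exact (h.2 p).isSquare_zmod hv

/-- The bound `|t| ≤ |b|/2` of the balanced residue is what makes the descent decrease. -/
theorem exists_small_sqrt {a b : ℤ} (hb : b ≠ 0) (h : IsSquare (a : ZMod b.natAbs)) :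
    ∃ t : ℤ, 2 * t.natAbs ≤ b.natAbs ∧ b ∣ t ^ 2 - a := by
  have : NeZero b.natAbs := ⟨by simpa using hb⟩
  obtain ⟨r, hr⟩ := h
  refine ⟨r.valMinAbs, by have := r.natAbs_valMinAbs_le; omega, ?_⟩
  rw [← Int.natAbs_dvd, ← ZMod.intCast_zmod_eq_zero_iff_dvd]
  rw [Int.cast_sub, Int.cast_pow, ZMod.coe_valMinAbs, hr]
  ring

theorem exists_squarefree_mul_sq {n : ℤ} (hn : n ≠ 0) :
    ∃ c u : ℤ, n = c * u ^ 2 ∧ Squarefree c ∧ u ≠ 0 := by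
  obtain ⟨c, u, h, hc⟩ := Nat.sq_mul_squarefree n.natAbs
  have hu : (u : ℤ) ≠ 0 := by
    rintro h0
    simp only [Int.natCast_eq_zero] at h0
    subst h0
    exact hn (by simpa using h.symm)
  rcases Int.natAbs_eq n with h1 | h1
  · exact ⟨c, u, by rw [h1, ← h]; push_cast; ring, by
      rwa [← Int.squarefree_natAbs, Int.natAbs_natCast], hu⟩
  · exact ⟨-c, u, by rw [h1, ← h]; push_cast; ring, by
      rwa [← Int.squarefree_natAbs, Int.natAbs_neg, Int.natAbs_natCast], hu⟩

/-- Legendre's descent on `|a| + |b|`, with `|a| ≤ |b|`. Writing `t² - a = b c u²` with `c`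
square-free, `b c` is a norm from `k(√a)` up to a square, so `b` may be replaced by `c` globally and
at every place. At the bottom only `(-1, -1)` is unsolvable, and the real place excludes it. -/
theorem isHilbertSolvable_of_isLocallySolvable {a b : ℤ} (ha : Squarefree a) (hb : Squarefree b)
    (h : IsLocallySolvable a b) : IsHilbertSolvable ℚ (a : ℚ) (b : ℚ) := by
  induction hm : a.natAbs + b.natAbs using Nat.strong_induction_on generalizing a b with
  | _ m ih =>
  wlog hab : a.natAbs ≤ b.natAbs generalizing a b
  · exact (this hb ha h.symm (by omega) (by omega)).symm
  have ha0 := ha.ne_zero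
  have hb0 := hb.ne_zero
  rcases Nat.lt_or_ge b.natAbs 2 with hb2 | hb2
  · obtain rfl | ha1 : a = 1 ∨ a = -1 := by omega
    · exact .of_isSquare_left (by simp)
    obtain rfl | hb1 : b = 1 ∨ b = -1 := by omega
    · exact .of_isSquare_right (by simp)
    have := (isHilbertSolvable_real_iff (by simpa using ha0) (by simpa using hb0)).mp h.1
    subst ha1 hb1
    norm_num at this
  obtain ⟨t, ht, n, hn⟩ := exists_small_sqrt hb0 (h.isSquare_zmod hb)
  by_cases hta : t ^ 2 = a
  · exact .of_isSquare_left ⟨t, by rw [← hta]; push_cast; ring⟩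
  have hn0 : n ≠ 0 := by
    rintro rfl
    exact hta (by linear_combination hn)
  obtain ⟨c, u, rfl, hc, hu⟩ := exists_squarefree_mul_sq hn0
  -- `|b||c| ≤ t² + |a| ≤ b²/4 + |b|`, which is less than `b²` once `|b| ≥ 2`.
  have hlt : c.natAbs < b.natAbs := by
    have h1 : (b * (c * u ^ 2)).natAbs ≤ t.natAbs ^ 2 + a.natAbs := by
      rw [← hn, ← Int.natAbs_pow]; omega
    rw [Int.natAbs_mul, Int.natAbs_mul, Int.natAbs_pow] at h1
    have hu : 1 ≤ u.natAbs := by omega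
    have hu' : 1 ≤ u.natAbs ^ 2 := Nat.one_le_pow _ _ hu
    have h3 : c.natAbs ≤ c.natAbs * u.natAbs ^ 2 := Nat.le_mul_of_pos_right _ hu'
    by_contra! hn
    have h4 : b.natAbs * b.natAbs ≤ t.natAbs ^ 2 + a.natAbs :=
      (Nat.mul_le_mul_left _ (hn.trans h3)).trans h1
    have h5 : (2 * t.natAbs) ^ 2 ≤ b.natAbs ^ 2 := Nat.pow_le_pow_left ht 2
    nlinarith
  have hn : t ^ 2 - a = b * c * u ^ 2 := by rw [hn]; ring
  -- The norm relation is symmetric in `b` and `c` and holds over `ℚ`, `ℝ` and each `ℚ_[p]` alike.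
  have hcast : ∀ (k : Type) [Field k] [CharZero k], IsHilbertSolvable k (a : k) (b : k) ↔
      IsHilbertSolvable k (a : k) (c : k) := fun k _ _ =>
    ⟨.of_norm (t := (t : k)) (u := (u : k)) (by exact_mod_cast hb0) (by exact_mod_cast hu)
      (by exact_mod_cast hta) (by exact_mod_cast hn),
    .of_norm (t := (t : k)) (u := (u : k)) (by exact_mod_cast hc.ne_zero) (by exact_mod_cast hu)
      (by exact_mod_cast hta) (by rw [mul_comm b c] at hn; exact_mod_cast hn)⟩
  exact (hcast ℚ).mpr (ih _ (by omega) ha hc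
    ⟨(hcast ℝ).mp h.1, fun p _ => (hcast ℚ_[p]).mp (h.2 p)⟩ rfl)

theorem isHilbertSolvable_rat_iff {a b : ℤ} (ha : Squarefree a) (hb : Squarefree b) :
    IsHilbertSolvable ℚ (a : ℚ) (b : ℚ) ↔ IsLocallySolvable a b := by
  refine ⟨fun h => ⟨?_, fun p _ => ?_⟩, isHilbertSolvable_of_isLocallySolvable ha hb⟩
  · simpa using h.map (algebraMap ℚ ℝ)
  · simpa using h.map (algebraMap ℚ ℚ_[p])

/-! ### The dihedral group of order `8` -/

/-- The element `s` is a reflection with respect to the rotation `g` of order `4`, and the two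
generate the group. -/
def IsReflectionFor {G : Type*} [Group G] (g s : G) : Prop :=
  s * s = 1 ∧ s * g = g * g * g * s ∧
    ∀ h : G, ∃ i : Fin 4, h = g ^ (i : ℕ) ∨ h = g ^ (i : ℕ) * s

/-- Two reflections from different conjugacy classes are supplied, since it is not known in advance
which one fixes `√a`. -/
theorem dihedralGroup_four_exists_reflection : ∀ g : DihedralGroup 4, g * g ≠ 1 →
    g * g * g * g = 1 ∧ ∃ s, IsReflectionFor g s ∧ IsReflectionFor g (g * s) := by
  unfold IsReflectionFor
  decide

theorem IsReflectionFor.of_mulEquiv {G H : Type*} [Group G] [Group H] (e : G ≃* H) {g s : H}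
    (h : IsReflectionFor g s) : IsReflectionFor (e.symm g) (e.symm s) := by
  obtain ⟨h1, h2, h3⟩ := h
  refine ⟨by rw [← map_mul, h1, map_one], by simp only [← map_mul, h2], fun k => ?_⟩
  obtain ⟨i, hi⟩ := h3 (e k)
  refine ⟨i, ?_⟩
  rw [← map_pow, ← map_mul, e.eq_symm_apply, e.eq_symm_apply]
  exact hi

section Lift

variable {G : Type*} [Group G] (ρ τ : G)

/-- The homomorphism from the dihedral group of order `8` given by a rotation and a reflection. -/
def dihedralLift (h4 : ρ ^ 4 = 1) (hτ : τ * τ = 1) (h : τ * ρ * τ * ρ = 1) :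
    DihedralGroup 4 →* G :=
  have hadd : ∀ i j : ZMod 4, ρ ^ (i + j).val = ρ ^ i.val * ρ ^ j.val := fun i j => by
    rw [ZMod.val_add, ← pow_eq_pow_mod _ h4, pow_add]
  have hsub : ∀ i j : ZMod 4, ρ ^ (j - i).val = (ρ ^ i.val)⁻¹ * ρ ^ j.val := fun i j => by
    rw [eq_inv_mul_iff_mul_eq, ← hadd, add_sub_cancel]
  have hinv : τ⁻¹ = τ := inv_eq_of_mul_eq_one_left hτ
  have hconj : ∀ n : ℕ, τ * ρ ^ n * τ = (ρ ^ n)⁻¹ := fun n => by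
    have h1 : τ * ρ * τ⁻¹ = ρ⁻¹ := by rw [hinv]; exact eq_inv_of_mul_eq_one_left h
    rw [← inv_pow, ← h1, conj_pow, hinv]
  have hcomm : ∀ n : ℕ, ρ ^ n * τ = τ * (ρ ^ n)⁻¹ := fun n => by
    rw [← hconj, ← mul_assoc, ← mul_assoc, hτ, one_mul]
  { toFun := fun x => match x with
      | .r i => ρ ^ i.val
      | .sr i => τ * ρ ^ i.val
    map_one' := pow_zero ρ
    map_mul' := by
      rintro (i | i) (j | j)
      · simp [hadd]
      · simp only [DihedralGroup.r_mul_sr, hsub]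
        rw [← mul_assoc, ← mul_assoc, hcomm]
      · simp [hadd, mul_assoc]
      · simp only [DihedralGroup.sr_mul_sr, hsub]
        rw [← mul_assoc, hconj] }

theorem dihedralLift_r (h4 : ρ ^ 4 = 1) (hτ : τ * τ = 1) (h : τ * ρ * τ * ρ = 1) (i : ZMod 4) :
    dihedralLift ρ τ h4 hτ h (.r i) = ρ ^ i.val := rfl

theorem dihedralLift_sr (h4 : ρ ^ 4 = 1) (hτ : τ * τ = 1) (h : τ * ρ * τ * ρ = 1) (i : ZMod 4) :
    dihedralLift ρ τ h4 hτ h (.sr i) = τ * ρ ^ i.val := rfl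

end Lift

/-! ### From a `D₄`-extension to a solution of the norm equation. -/

section Galois

variable {F : Type*} [Field F] [Algebra ℚ F]

theorem apply_eq_or_eq_neg (g : F ≃ₐ[ℚ] F) {s : F} {a : ℚ} (hs : s ^ 2 = algebraMap ℚ F a) :
    g s = s ∨ g s = -s := by
  rw [← sq_eq_sq_iff_eq_or_eq_neg, ← map_pow, hs, AlgEquiv.commutes]

theorem not_mem_range_of_not_isSquare {s : F} {a : ℚ} (hs : s ^ 2 = algebraMap ℚ F a)
    (ha : ¬ IsSquare a) (q : ℚ) : s ≠ algebraMap ℚ F q := by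
  rintro rfl
  rw [← map_pow] at hs
  exact ha ⟨q, by rw [← (algebraMap ℚ F).injective hs, sq]⟩

theorem ne_zero_of_not_isSquare {s : F} {a : ℚ} (hs : s ^ 2 = algebraMap ℚ F a)
    (ha : ¬ IsSquare a) : s ≠ 0 := by
  simpa using not_mem_range_of_not_isSquare hs ha 0

theorem mem_range_of_fixed [IsGalois ℚ F] {σ τ : F ≃ₐ[ℚ] F}
    (h : IsReflectionFor σ τ) {x : F} (hσ : σ x = x) (hτ : τ x = x) :
    ∃ q : ℚ, x = algebraMap ℚ F q := by
  have hσ' : σ ∈ MulAction.stabilizer (F ≃ₐ[ℚ] F) x := hσ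
  have hτ' : τ ∈ MulAction.stabilizer (F ≃ₐ[ℚ] F) x := hτ
  have : x ∈ Set.range (algebraMap ℚ F) := by
    rw [InfiniteGalois.mem_range_algebraMap_iff_fixed]
    intro g
    obtain ⟨i, rfl | rfl⟩ := h.2.2 g
    · exact pow_mem hσ' _
    · exact mul_mem (pow_mem hσ' _) hτ'
  obtain ⟨q, hq⟩ := this
  exact ⟨q, hq.symm⟩

/-- For `θ ≠ 0` with `τθ = θ` and `σ²θ = -θ`, one has `θ² = u + v s`, `(σθ)² = u - v s` and `θ·σθ =
w t` with rational `u, v, w`. Multiplying the first two gives `u² - a v² = b w²`. -/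
theorem isHilbertSolvable_of_reflection [IsGalois ℚ F] {a b : ℚ} {s t : F}
    (hs : s ^ 2 = algebraMap ℚ F a) (ht : t ^ 2 = algebraMap ℚ F b) (hs0 : s ≠ 0) (ht0 : t ≠ 0)
    {σ τ : F ≃ₐ[ℚ] F} (h : IsReflectionFor σ τ) (hσ4 : σ * σ * σ * σ = 1) (hσ2 : σ * σ ≠ 1)
    (hσs : σ s = -s) (hσt : σ t = -t) (hτs : τ s = s) (hτt : τ t = -t) :
    IsHilbertSolvable ℚ a b := by
  have h4 : ∀ x, σ (σ (σ (σ x))) = x := fun x => DFunLike.congr_fun hσ4 x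
  have hττ : ∀ x, τ (τ x) = x := fun x => DFunLike.congr_fun h.1 x
  have hτσ : ∀ x, τ (σ x) = σ (σ (σ (τ x))) := fun x => DFunLike.congr_fun h.2.1 x
  have h2 : (2 : F) ≠ 0 := by
    have := algebraRat.charZero F
    exact two_ne_zero
  -- The expression projects, up to a factor, onto the space where `τ = 1` and `σ² = -1`. If it
  -- vanished at every `x` and `x t`, adding the two relations would give `σ²x = x` for all `x`.
  obtain ⟨x, hx⟩ : ∃ x, x + τ x - σ (σ x) - σ (σ (τ x)) ≠ 0 := by
    by_contra! hn
    refine hσ2 (AlgEquiv.ext fun x => ?_)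
    have h1 := hn x
    have h3 := hn (x * t)
    simp only [map_mul, hτt, hσt, map_neg] at h3
    have h5 : x - τ x - σ (σ x) + σ (σ (τ x)) = 0 :=
      (mul_eq_zero.mp (show t * _ = 0 by linear_combination h3)).resolve_left ht0
    refine mul_left_cancel₀ h2 ?_
    simp only [AlgEquiv.mul_apply, AlgEquiv.one_apply]
    linear_combination -h1 - h5
  set θ := x + τ x - σ (σ x) - σ (σ (τ x)) with hθ
  have hτθ : τ θ = θ := by
    simp only [hθ, map_add, map_sub, hτσ, hττ, h4]
    ring
  have hσθ : σ (σ θ) = -θ := by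
    simp only [hθ, map_add, map_sub, h4]
    ring
  have hτσθ : τ (σ θ) = -σ θ := by rw [hτσ, hτθ, hσθ, map_neg]
  obtain ⟨u, hu⟩ := mem_range_of_fixed h (x := (θ ^ 2 + σ θ ^ 2) / 2)
    (by simp only [map_div₀, map_add, map_pow, map_ofNat, hσθ]; ring)
    (by simp only [map_div₀, map_add, map_pow, map_ofNat, hτθ, hτσθ]; ring)
  obtain ⟨v, hv⟩ := mem_range_of_fixed h (x := (θ ^ 2 - σ θ ^ 2) / (2 * s))
    (by simp only [map_div₀, map_mul, map_sub, map_pow, map_ofNat, hσθ, hσs]; field_simp; ring)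
    (by simp only [map_div₀, map_mul, map_sub, map_pow, map_ofNat, hτθ, hτσθ, hτs]; ring)
  obtain ⟨w, hw⟩ := mem_range_of_fixed h (x := θ * σ θ / t)
    (by simp only [map_div₀, map_mul, hσθ, hσt]; field_simp)
    (by simp only [map_div₀, map_mul, hτθ, hτσθ, hτt]; field_simp)
  refine ⟨v, w, u, fun h0 => ?_, (algebraMap ℚ F).injective ?_⟩
  · simp only [Prod.mk.injEq] at h0
    rw [h0.2.1, map_zero, div_eq_zero_iff, mul_eq_zero, map_eq_zero] at hw
    tauto
  · simp only [map_add, map_mul, map_pow, ← hs, ← ht, ← hu, ← hv, ← hw]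
    field_simp
    ring

/-- Were `s` and `t` fixed by `σ`, the reflection `ρ` would have to negate `s`, `t` and `st`, which
is impossible. So `σ` negates both, and `ρ`, which moves `st`, negates exactly one of them; if that
is `s`, then `σρ` negates `t` instead. -/
theorem isHilbertSolvable_of_dihedral [IsGalois ℚ F] (e : (F ≃ₐ[ℚ] F) ≃* DihedralGroup 4)
    {a b : ℚ} {s t : F} (hs : s ^ 2 = algebraMap ℚ F a) (ht : t ^ 2 = algebraMap ℚ F b)
    (ha : ¬ IsSquare a) (hb : ¬ IsSquare b) (hab : ¬ IsSquare (a * b))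
    {σ : F ≃ₐ[ℚ] F} (hσ : σ * σ ≠ 1) (hst : σ (s * t) = s * t) : IsHilbertSolvable ℚ a b := by
  have hst2 : (s * t) ^ 2 = algebraMap ℚ F (a * b) := by rw [mul_pow, hs, ht, map_mul]
  have hs0 := ne_zero_of_not_isSquare hs ha
  have ht0 := ne_zero_of_not_isSquare ht hb
  obtain ⟨h4, ρ, hρ, hσρ⟩ := dihedralGroup_four_exists_reflection (e σ) (by
    rwa [← map_mul, Ne, EmbeddingLike.map_eq_one_iff])
  replace h4 : σ * σ * σ * σ = 1 := e.injective (by simpa using h4)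
  replace hρ := hρ.of_mulEquiv e
  replace hσρ := hσρ.of_mulEquiv e
  rw [map_mul] at hσρ
  rw [e.symm_apply_apply] at hρ hσρ
  generalize e.symm ρ = ρ at hρ hσρ
  have key : ∀ {x : F} {c : ℚ}, x ^ 2 = algebraMap ℚ F c → ¬ IsSquare c → σ x = x → ρ x ≠ x :=
    fun hx hc h1 h2 => by
      obtain ⟨q, hq⟩ := mem_range_of_fixed hρ h1 h2
      exact not_mem_range_of_not_isSquare hx hc q hq
  have hρst := key hst2 hab hst
  rw [map_mul] at hst hρst
  have hσs : σ s = -s := by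
    refine (apply_eq_or_eq_neg σ hs).resolve_left fun h1 => ?_
    rw [h1] at hst
    have h2 := mul_left_cancel₀ hs0 hst
    have h3 := (apply_eq_or_eq_neg ρ hs).resolve_left (key hs ha h1)
    have h4 := (apply_eq_or_eq_neg ρ ht).resolve_left (key ht hb h2)
    exact hρst (by rw [h3, h4, neg_mul_neg])
  have hσt : σ t = -t := by
    rw [hσs] at hst
    exact mul_left_cancel₀ hs0 (by linear_combination -hst)
  rcases apply_eq_or_eq_neg ρ hs with h1 | h1 <;> rcases apply_eq_or_eq_neg ρ ht with h2 | h2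
  · exact absurd (by rw [h1, h2]) hρst
  · exact isHilbertSolvable_of_reflection hs ht hs0 ht0 hρ h4 hσ hσs hσt h1 h2
  · exact isHilbertSolvable_of_reflection hs ht hs0 ht0 hσρ h4 hσ hσs hσt
      (by simp [h1, hσs]) (by simp [h2, hσt])
  · exact absurd (by rw [h1, h2, neg_mul_neg]) hρst

/-- In a `D₄`-extension, a generator of a subgroup fixing a square root of a rational number has
order greater than `2`. -/
theorem mul_self_ne_one_of_forall_mem_zpowers (e : (F ≃ₐ[ℚ] F) ≃* DihedralGroup 4) {m : F} {c : ℚ}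
    (hm : m ^ 2 = algebraMap ℚ F c) {ρ : F ≃ₐ[ℚ] F}
    (hρ : ∀ g : F ≃ₐ[ℚ] F, g m = m → g ∈ Subgroup.zpowers ρ) : ρ * ρ ≠ 1 := by
  intro h1
  have key : ∀ g : F ≃ₐ[ℚ] F, g m = m → g = 1 ∨ g = ρ := fun g hg => by
    obtain ⟨k, rfl⟩ := Subgroup.mem_zpowers_iff.mp (hρ g hg)
    rcases Int.even_or_odd' k with ⟨l, rfl | rfl⟩
    · left; rw [zpow_mul, zpow_ofNat, sq, h1, one_zpow]
    · right; rw [zpow_add, zpow_mul, zpow_ofNat, sq, h1, one_zpow, zpow_one, one_mul]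
  have key2 : ∀ g h : F ≃ₐ[ℚ] F, g m = m → h m = m → g ≠ 1 → h ≠ 1 → g = h :=
    fun g h hg hh hg1 hh1 => by
      rw [(key g hg).resolve_left hg1, (key h hh).resolve_left hh1]
  -- The stabilizer of `m` is too big for `{1, ρ}`: besides `κ²` it contains `κ`, `l` or `κl`,
  -- depending on signs.
  obtain ⟨κ, hκ⟩ := e.surjective (.r 1)
  obtain ⟨l, hl⟩ := e.surjective (.sr 0)
  have hne : ∀ g h : F ≃ₐ[ℚ] F, e g ≠ e h → g ≠ h := fun g h hgh h1 => hgh (by rw [h1])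
  have hκ2 : (κ * κ) m = m := by
    rcases apply_eq_or_eq_neg κ hm with h | h <;> simp [h]
  have hκ1 : κ * κ ≠ 1 := hne _ _ (by simp only [map_mul, map_one, hκ]; decide)
  rcases apply_eq_or_eq_neg κ hm with h | h
  · exact hne (κ * κ) κ (by simp only [map_mul, hκ]; decide)
      (key2 _ _ hκ2 h hκ1 (hne _ _ (by simp only [map_one, hκ]; decide)))
  rcases apply_eq_or_eq_neg l hm with h' | h'
  · exact hne (κ * κ) l (by simp only [map_mul, hκ, hl]; decide)
      (key2 _ _ hκ2 h' hκ1 (hne _ _ (by simp only [map_one, hl]; decide)))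
  · exact hne (κ * κ) (κ * l) (by simp only [map_mul, hκ, hl]; decide)
      (key2 _ _ hκ2 (by simp [h, h']) hκ1
        (hne _ _ (by simp only [map_mul, map_one, hκ, hl]; decide)))

/-! ### Construction of `D₄`-extensions -/

theorem exists_apply_eq_neg [IsGalois ℚ F] {s : F} {a : ℚ} (hs : s ^ 2 = algebraMap ℚ F a)
    (ha : ¬ IsSquare a) : ∃ g : F ≃ₐ[ℚ] F, g s = -s := by
  by_contra! hn
  have : s ∈ Set.range (algebraMap ℚ F) := by
    rw [InfiniteGalois.mem_range_algebraMap_iff_fixed]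
    exact fun g => (apply_eq_or_eq_neg g hs).resolve_right (hn g)
  obtain ⟨q, hq⟩ := this
  exact not_mem_range_of_not_isSquare hs ha q hq.symm

theorem exists_apply_neg_neg_and_apply_self_neg [IsGalois ℚ F] {a b : ℚ} {s t : F}
    (hs : s ^ 2 = algebraMap ℚ F a) (ht : t ^ 2 = algebraMap ℚ F b)
    (ha : ¬ IsSquare a) (hb : ¬ IsSquare b) (hab : ¬ IsSquare (a * b)) :
    (∃ g : F ≃ₐ[ℚ] F, g s = -s ∧ g t = -t) ∧ ∃ g : F ≃ₐ[ℚ] F, g s = s ∧ g t = -t := by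
  have hst2 : (s * t) ^ 2 = algebraMap ℚ F (a * b) := by rw [mul_pow, hs, ht, map_mul]
  obtain ⟨g₁, h₁⟩ := exists_apply_eq_neg hs ha
  obtain ⟨g₂, h₂⟩ := exists_apply_eq_neg ht hb
  obtain ⟨g₃, h₃⟩ := exists_apply_eq_neg hst2 hab
  have hst0 := ne_zero_of_not_isSquare hst2 hab
  have h2 : ∀ x : F, x ≠ 0 → x ≠ -x := fun x hx h => by
    have := algebraRat.charZero F
    exact hx (self_eq_neg.mp h)
  rcases apply_eq_or_eq_neg g₁ ht with h | h
  · rcases apply_eq_or_eq_neg g₂ hs with h' | h'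
    · exact ⟨⟨g₁ * g₂, by simp [*]⟩, g₂, h', h₂⟩
    · exact ⟨⟨g₂, h', h₂⟩, g₁ * g₂, by simp [*]⟩
  · refine ⟨⟨g₁, h₁, h⟩, ?_⟩
    rw [map_mul] at h₃
    rcases apply_eq_or_eq_neg g₃ hs with h' | h' <;> rcases apply_eq_or_eq_neg g₃ ht with h'' | h''
    · rw [h', h''] at h₃
      exact absurd h₃ (h2 _ hst0)
    · exact ⟨g₃, h', h''⟩
    · exact ⟨g₁ * g₃, by simp [*]⟩
    · rw [h', h'', neg_mul_neg] at h₃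
      exact absurd h₃ (h2 _ hst0)

/-- If `F/ℚ` is Galois and generated by `θ, θ'` with `θ² = u + v√a` and `θθ' = w√b`, then its group
is dihedral and the subgroup fixing `√a√b` is cyclic. -/
theorem exists_dihedral [IsGalois ℚ F] {a b u v w : ℚ} {s t θ θ' : F}
    (hs : s ^ 2 = algebraMap ℚ F a) (ht : t ^ 2 = algebraMap ℚ F b)
    (ha : ¬ IsSquare a) (hb : ¬ IsSquare b) (hab : ¬ IsSquare (a * b)) (hw : w ≠ 0)
    (huv : u ^ 2 - a * v ^ 2 = b * w ^ 2)
    (hθ : θ ^ 2 = algebraMap ℚ F u + algebraMap ℚ F v * s)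
    (hθ' : θ * θ' = algebraMap ℚ F w * t)
    (hext : ∀ g : F ≃ₐ[ℚ] F, g θ = θ → g θ' = θ' → g = 1) :
    Nonempty ((F ≃ₐ[ℚ] F) ≃* DihedralGroup 4) ∧
      ∃ ρ : F ≃ₐ[ℚ] F, ρ (s * t) = s * t ∧
        ∀ g : F ≃ₐ[ℚ] F, g (s * t) = s * t → g ∈ Subgroup.zpowers ρ := by
  have hs0 := ne_zero_of_not_isSquare hs ha
  have ht0 := ne_zero_of_not_isSquare ht hb
  have hne : ∀ x : F, x ≠ 0 → -x ≠ x := fun x hx h => by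
    have := algebraRat.charZero F
    exact hx (neg_eq_self.mp h)
  have hw0 : algebraMap ℚ F w ≠ 0 := (map_ne_zero _).mpr hw
  have hθθ' : θ * θ' ≠ 0 := by rw [hθ']; exact mul_ne_zero hw0 ht0
  have hθ0 := left_ne_zero_of_mul hθθ'
  have hθ'0 := right_ne_zero_of_mul hθθ'
  have hθ'2 : θ' ^ 2 = algebraMap ℚ F u - algebraMap ℚ F v * s := by
    have h1 := congrArg (algebraMap ℚ F) huv
    simp only [map_sub, map_mul, map_pow] at h1
    refine mul_left_cancel₀ (pow_ne_zero 2 hθ0) ?_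
    rw [← mul_pow, hθ', hθ]
    linear_combination algebraMap ℚ F w ^ 2 * ht - h1 + algebraMap ℚ F v ^ 2 * hs
  obtain ⟨⟨ρ, hρs, hρt⟩, τ, hτs, hτt⟩ :=
    exists_apply_neg_neg_and_apply_self_neg hs ht ha hb hab
  have happ : ∀ (g : F ≃ₐ[ℚ] F) {x : F}, g θ = x → g t = t → x * g θ' = θ * θ' := fun g x h1 h2 => by
    rw [← h1, ← map_mul, hθ', map_mul, AlgEquiv.commutes, h2]
  have happ' : ∀ (g : F ≃ₐ[ℚ] F) {x : F}, g θ = x → g t = -t → x * g θ' = -(θ * θ') :=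
    fun g x h1 h2 => by
      rw [← h1, ← map_mul, hθ', map_mul, AlgEquiv.commutes, h2, mul_neg]
  -- The sign of `ρθ = ±θ'` is undetermined, but as `ρ` negates `θθ' = w t`, both choices give `ρ² =
  -- -1` on `θ` and `θ'`.
  have hρθ : (ρ θ = θ' ∧ ρ θ' = -θ) ∨ (ρ θ = -θ' ∧ ρ θ' = θ) := by
    have : ρ θ = θ' ∨ ρ θ = -θ' := by
      rw [← sq_eq_sq_iff_eq_or_eq_neg, ← map_pow, hθ, hθ'2]
      simp [hρs, sub_eq_add_neg]
    refine this.imp (fun h => ⟨h, ?_⟩) (fun h => ⟨h, ?_⟩)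
    · exact mul_left_cancel₀ hθ'0 (by linear_combination happ' ρ h hρt)
    · exact mul_left_cancel₀ hθ'0 (by linear_combination -happ' ρ h hρt)
  have hfix : ∀ g : F ≃ₐ[ℚ] F, g s = s → g θ = θ ∨ g θ = -θ := fun g hg => by
    rw [← sq_eq_sq_iff_eq_or_eq_neg, ← map_pow, hθ]
    simp [hg]
  have hτθ : (τ θ = θ ∧ τ θ' = -θ') ∨ (τ θ = -θ ∧ τ θ' = θ') := by
    refine (hfix τ hτs).imp (fun h => ⟨h, ?_⟩) (fun h => ⟨h, ?_⟩)
    · exact mul_left_cancel₀ hθ0 (by linear_combination happ' τ h hτt)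
    · exact mul_left_cancel₀ hθ0 (by linear_combination -happ' τ h hτt)
  have hρρθ : ρ (ρ θ) = -θ := by rcases hρθ with ⟨h, h'⟩ | ⟨h, h'⟩ <;> simp [h, h']
  have hρρθ' : ρ (ρ θ') = -θ' := by rcases hρθ with ⟨h, h'⟩ | ⟨h, h'⟩ <;> simp [h, h']
  have h4 : ρ ^ 4 = 1 := hext _ (by simp [pow_succ, hρρθ]) (by simp [pow_succ, hρρθ'])
  have hττ : τ * τ = 1 := by
    rcases hτθ with ⟨h, h'⟩ | ⟨h, h'⟩ <;> exact hext _ (by simp [h]) (by simp [h'])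
  have hτρ : τ * ρ * τ * ρ = 1 := by
    rcases hτθ with ⟨h, h'⟩ | ⟨h, h'⟩ <;> rcases hρθ with ⟨k, k'⟩ | ⟨k, k'⟩ <;>
      exact hext _ (by simp [h, h', k, k']) (by simp [h, h', k, k'])
  have hρst : ρ (s * t) = s * t := by simp [hρs, hρt]
  -- An automorphism trivial on `s, t` sends `(θ, θ')` to `±(θ, θ')` with a common sign, so it is
  -- `1` or `ρ²`.
  have hone : ∀ g : F ≃ₐ[ℚ] F, g s = s → g t = t → g = 1 ∨ g = ρ ^ 2 := fun g h1 h2 => by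
    refine (hfix g h1).imp (fun h => ?_) (fun h => ?_)
    · exact hext g h (mul_left_cancel₀ hθ0 (happ g h h2))
    · have h' : g θ' = -θ' := mul_left_cancel₀ hθ0 (by linear_combination -happ g h h2)
      have : ρ ^ 2 * g = 1 :=
        hext _ (by simp [sq, h, hρρθ]) (by simp [sq, h', hρρθ'])
      rw [eq_inv_of_mul_eq_one_right this, inv_eq_iff_mul_eq_one, ← pow_add, h4]
  have hpow : ∀ g : F ≃ₐ[ℚ] F, g (s * t) = s * t → ∃ i : ZMod 4, g = ρ ^ i.val := fun g hg => by
    rw [map_mul] at hg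
    rcases apply_eq_or_eq_neg g hs with h | h
    · rw [h] at hg
      rcases hone g h (mul_left_cancel₀ hs0 hg) with h | h
      · exact ⟨0, h⟩
      · exact ⟨2, h⟩
    · rw [h] at hg
      have h' : g t = -t := mul_left_cancel₀ hs0 (by linear_combination -hg)
      rcases hone (ρ * g) (by simp [h, hρs]) (by simp [h', hρt]) with h | h
      · refine ⟨3, (eq_inv_of_mul_eq_one_right h).trans ?_⟩
        rw [inv_eq_iff_mul_eq_one]
        exact (pow_succ' ρ 3).symm.trans h4
      · exact ⟨1, mul_left_cancel (h.trans (sq ρ)) |>.trans (pow_one ρ).symm⟩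
  refine ⟨⟨(MulEquiv.ofBijective (dihedralLift ρ τ h4 hττ hτρ) ⟨?_, fun g => ?_⟩).symm⟩,
    ρ, hρst, fun g hg => ?_⟩
  -- `τρⁱ` negates `st`, hence is never `1`; odd powers of `ρ` move `s`, and `ρ²` moves `θ`.
  · rw [injective_iff_map_eq_one]
    have hstab : ∀ i : ℕ, (ρ ^ i) (s * t) = s * t := fun i =>
      pow_mem (show ρ ∈ MulAction.stabilizer (F ≃ₐ[ℚ] F) (s * t) from hρst) i
    rintro (i | i) hi
    · rw [dihedralLift_r] at hi
      have h2 : ∀ x : F, (ρ ^ i.val) x = x := fun x => by rw [hi]; rfl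
      have h3 : i = 0 ∨ i = 1 ∨ i = 2 ∨ i = 3 := by clear hi h2; revert i; decide
      rcases h3 with rfl | rfl | rfl | rfl
      · rfl
      · exact absurd (h2 s) (by
          rw [show (1 : ZMod 4).val = 1 from rfl, pow_one, hρs]; exact hne s hs0)
      · exact absurd (h2 θ) (by
          rw [show (2 : ZMod 4).val = 2 from rfl, sq, AlgEquiv.mul_apply, hρρθ]; exact hne θ hθ0)
      · exact absurd (h2 s) (by
          rw [show (3 : ZMod 4).val = 3 from rfl]; simpa [pow_succ, hρs] using hne s hs0)
    · rw [dihedralLift_sr] at hi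
      have h2 : (τ * ρ ^ i.val) (s * t) = s * t := by rw [hi]; rfl
      rw [AlgEquiv.mul_apply, hstab, map_mul, hτs, hτt, mul_neg] at h2
      exact absurd h2 (hne _ (mul_ne_zero hs0 ht0))
  · have hst2 : (s * t) ^ 2 = algebraMap ℚ F (a * b) := by rw [mul_pow, hs, ht, map_mul]
    rcases apply_eq_or_eq_neg g hst2 with h | h
    · obtain ⟨i, rfl⟩ := hpow g h
      exact ⟨.r i, rfl⟩
    · obtain ⟨i, hi⟩ := hpow (τ * g) (by
        rw [AlgEquiv.mul_apply, h, map_neg, map_mul, hτs, hτt, mul_neg, neg_neg])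
      refine ⟨.sr i, ?_⟩
      rw [dihedralLift_sr, ← hi, ← mul_assoc, hττ, one_mul]
  · obtain ⟨i, rfl⟩ := hpow g hg
    exact Subgroup.npow_mem_zpowers _ _

end Galois

/-! ### Subfields of an algebraic closure of `ℚ` -/

section Fields

variable {Ω : Type*} [Field Ω] [Algebra ℚ Ω]

/-- An automorphism of `F` over `M ≤ F`, as an automorphism over `ℚ`. -/
def restrictToRat {F M : IntermediateField ℚ Ω} (h : M ≤ F) :
    (IntermediateField.extendScalars h ≃ₐ[M] IntermediateField.extendScalars h) →*
      (F ≃ₐ[ℚ] F) where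
  toFun φ := AlgEquiv.ofRingEquiv (f := (φ.toRingEquiv : F ≃+* F)) fun q =>
    φ.commutes (algebraMap ℚ M q)
  map_one' := rfl
  map_mul' _ _ := rfl

theorem restrictToRat_injective {F M : IntermediateField ℚ Ω} (h : M ≤ F) :
    Function.Injective (restrictToRat h) := fun _ _ hφ =>
  AlgEquiv.ext fun x => DFunLike.congr_fun hφ x

theorem restrictToRat_apply_of_mem {F M : IntermediateField ℚ Ω} (h : M ≤ F)
    (φ : IntermediateField.extendScalars h ≃ₐ[M] IntermediateField.extendScalars h)
    {m : Ω} (hm : m ∈ M) : restrictToRat h φ ⟨m, h hm⟩ = ⟨m, h hm⟩ :=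
  φ.commutes ⟨m, hm⟩

theorem exists_restrictToRat_eq {F M : IntermediateField ℚ Ω} (h : M ≤ F) {g : F ≃ₐ[ℚ] F}
    (hg : ∀ (m : Ω) (hm : m ∈ M), g ⟨m, h hm⟩ = ⟨m, h hm⟩) : ∃ φ, restrictToRat h φ = g :=
  ⟨AlgEquiv.ofRingEquiv
    (f := (g.toRingEquiv : IntermediateField.extendScalars h ≃+* IntermediateField.extendScalars h))
    fun m => hg m m.2, rfl⟩

theorem coe_algebraMap_rat (F : IntermediateField ℚ Ω) (q : ℚ) :
    ((algebraMap ℚ F q : F) : Ω) = algebraMap ℚ Ω q := by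
  rw [eq_ratCast, eq_ratCast]
  exact map_ratCast F.val q

theorem pow_eq_algebraMap_of_coe {F : IntermediateField ℚ Ω} {x : Ω} {hx : x ∈ F} {n : ℕ} {q : ℚ}
    (h : x ^ n = algebraMap ℚ Ω q) : (⟨x, hx⟩ : F) ^ n = algebraMap ℚ F q :=
  Subtype.ext (by rw [coe_algebraMap_rat, ← h]; rfl)

theorem apply_eq_of_mem_adjoin {F : IntermediateField ℚ Ω} {S : Set Ω} {g : F ≃ₐ[ℚ] F}
    (hg : ∀ m ∈ S, ∃ hF : m ∈ F, g ⟨m, hF⟩ = ⟨m, hF⟩) (x : Ω)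
    (hx : x ∈ IntermediateField.adjoin ℚ S) : ∃ hF : x ∈ F, g ⟨x, hF⟩ = ⟨x, hF⟩ := by
  induction hx using IntermediateField.adjoin_induction with
  | mem x hx => exact hg x hx
  | algebraMap q =>
    refine ⟨F.algebraMap_mem q, ?_⟩
    rw [show (⟨algebraMap ℚ Ω q, F.algebraMap_mem q⟩ : F) = algebraMap ℚ F q from
      Subtype.ext (coe_algebraMap_rat F q).symm, AlgEquiv.commutes]
  | add x y _ _ hx hy =>
    obtain ⟨hx, hx'⟩ := hx
    obtain ⟨hy, hy'⟩ := hy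
    exact ⟨add_mem hx hy, (map_add g ⟨x, hx⟩ ⟨y, hy⟩).trans (by rw [hx', hy']; rfl)⟩
  | inv x _ hx =>
    obtain ⟨hx, hx'⟩ := hx
    exact ⟨inv_mem hx, (map_inv₀ g ⟨x, hx⟩).trans (by rw [hx']; rfl)⟩
  | mul x y _ _ hx hy =>
    obtain ⟨hx, hx'⟩ := hx
    obtain ⟨hy, hy'⟩ := hy
    exact ⟨mul_mem hx hy, (map_mul g ⟨x, hx⟩ ⟨y, hy⟩).trans (by rw [hx', hy']; rfl)⟩

/-- The group of `F` over `ℚ(m)` is the stabilizer of `m` in the group over `ℚ`. This form avoids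
the tower of scalars. -/
theorem isCyclicOver_adjoin_iff {F : IntermediateField ℚ Ω} [IsGalois ℚ F] {m : Ω} (hm : m ∈ F) :
    IsCyclicOver F ℚ⟮m⟯ ↔ ∃ ρ : F ≃ₐ[ℚ] F, ρ ⟨m, hm⟩ = ⟨m, hm⟩ ∧
      ∀ g : F ≃ₐ[ℚ] F, g ⟨m, hm⟩ = ⟨m, hm⟩ → g ∈ Subgroup.zpowers ρ := by
  have hmm : m ∈ ℚ⟮m⟯ := IntermediateField.mem_adjoin_simple_self ℚ m
  constructor
  · rintro ⟨h, -, hc⟩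
    obtain ⟨φ, hφ⟩ := hc.exists_generator
    refine ⟨restrictToRat h φ, restrictToRat_apply_of_mem h φ hmm, fun g hg => ?_⟩
    obtain ⟨ψ, rfl⟩ := exists_restrictToRat_eq h fun x hx =>
      (apply_eq_of_mem_adjoin (S := {m}) (by rintro _ rfl; exact ⟨hm, hg⟩) x hx).2
    obtain ⟨k, rfl⟩ := Subgroup.mem_zpowers_iff.mp (hφ ψ)
    rw [map_zpow]
    exact Subgroup.zpow_mem_zpowers _ _
  · rintro ⟨ρ, hρ, hg⟩
    have h : ℚ⟮m⟯ ≤ F := by simpa using hm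
    refine ⟨h, ?_, ?_⟩
    · have : IsGalois ℚ (IntermediateField.extendScalars h) := ‹IsGalois ℚ F›
      exact IsGalois.tower_top_of_isGalois ℚ ℚ⟮m⟯ (IntermediateField.extendScalars h)
    · obtain ⟨φ, rfl⟩ := exists_restrictToRat_eq h fun x hx =>
        (apply_eq_of_mem_adjoin (S := {m}) (by rintro _ rfl; exact ⟨hm, hρ⟩) x hx).2
      refine ⟨φ, fun ψ => ?_⟩
      obtain ⟨k, hk⟩ := Subgroup.mem_zpowers_iff.mp
        (hg (restrictToRat h ψ) (restrictToRat_apply_of_mem h ψ hmm))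
      exact ⟨k, restrictToRat_injective h (by rw [← hk, ← map_zpow])⟩

theorem exists_isD4Extension_of_isHilbertSolvable [IsAlgClosure ℚ Ω] {a b : ℚ} {s t : Ω}
    (hs : s ^ 2 = algebraMap ℚ Ω a) (ht : t ^ 2 = algebraMap ℚ Ω b)
    (ha : ¬ IsSquare a) (hb : ¬ IsSquare b) (hab : ¬ IsSquare (a * b))
    (h : IsHilbertSolvable ℚ a b) :
    ∃ F : IntermediateField ℚ Ω, IsD4Extension F ∧ ∃ (hs : s ∈ F) (ht : t ∈ F),
      ∃ ρ : F ≃ₐ[ℚ] F, ρ (⟨s, hs⟩ * ⟨t, ht⟩) = ⟨s, hs⟩ * ⟨t, ht⟩ ∧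
        ∀ g : F ≃ₐ[ℚ] F, g (⟨s, hs⟩ * ⟨t, ht⟩) = ⟨s, hs⟩ * ⟨t, ht⟩ → g ∈ Subgroup.zpowers ρ := by
  have : IsAlgClosed Ω := IsAlgClosure.isAlgClosed ℚ
  obtain ⟨v, w, u, h0, huv⟩ := h
  replace huv : u ^ 2 - a * v ^ 2 = b * w ^ 2 := by linear_combination -huv
  -- `w = 0` would make `a` a square and `v = 0` would make `b` one. Dividing by `v` and `w` later
  -- recovers `s` and `t` from `θ, θ'`.
  have hw : w ≠ 0 := by
    rintro rfl
    by_cases hv : v = 0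
    · subst hv
      have : u ^ 2 = 0 := by linear_combination huv
      simp_all
    · exact ha ⟨u / v, by field_simp; linear_combination -huv⟩
  have hv : v ≠ 0 := by
    rintro rfl
    exact hb ⟨u / w, by field_simp; linear_combination -huv⟩
  have hw' : algebraMap ℚ Ω w ≠ 0 := (map_ne_zero _).mpr hw
  have hv' : algebraMap ℚ Ω v ≠ 0 := (map_ne_zero _).mpr hv
  have ht0 := ne_zero_of_not_isSquare ht hb
  have hprod : (algebraMap ℚ Ω u + algebraMap ℚ Ω v * s) *
      (algebraMap ℚ Ω u - algebraMap ℚ Ω v * s) = (algebraMap ℚ Ω w * t) ^ 2 := by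
    have h1 := congrArg (algebraMap ℚ Ω) huv
    simp only [map_sub, map_mul, map_pow] at h1
    linear_combination h1 - algebraMap ℚ Ω v ^ 2 * hs - algebraMap ℚ Ω w ^ 2 * ht
  have hprod0 := pow_ne_zero 2 (mul_ne_zero hw' ht0)
  rw [← hprod] at hprod0
  obtain ⟨θ, hθ⟩ := IsAlgClosed.exists_pow_nat_eq
    (algebraMap ℚ Ω u + algebraMap ℚ Ω v * s) two_pos
  have hθ0 : θ ≠ 0 := by
    rintro rfl
    rw [← hθ] at hprod0
    simp at hprod0
  -- Defining `θ'` by the product, not as a root of `u - v s`, fixes its sign.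
  obtain ⟨θ', hθ'⟩ : ∃ θ', θ * θ' = algebraMap ℚ Ω w * t :=
    ⟨algebraMap ℚ Ω w * t / θ, by field_simp⟩
  have hθ'2 : θ' ^ 2 = algebraMap ℚ Ω u - algebraMap ℚ Ω v * s := by
    refine mul_left_cancel₀ (pow_ne_zero 2 hθ0) ?_
    rw [← mul_pow, hθ', hθ, hprod]
  let F : IntermediateField ℚ Ω := ℚ⟮θ, θ'⟯
  have hθF : θ ∈ F := IntermediateField.subset_adjoin _ _ (by simp)
  have hθ'F : θ' ∈ F := IntermediateField.subset_adjoin _ _ (by simp)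
  have hsF : s ∈ F := by
    have : s = (θ ^ 2 - algebraMap ℚ Ω u) / algebraMap ℚ Ω v := by rw [hθ]; field_simp; ring
    rw [this]
    exact div_mem (sub_mem (pow_mem hθF 2) (F.algebraMap_mem u)) (F.algebraMap_mem v)
  have htF : t ∈ F := by
    have : t = θ * θ' / algebraMap ℚ Ω w := by rw [hθ']; field_simp
    rw [this]
    exact div_mem (mul_mem hθF hθ'F) (F.algebraMap_mem w)
  have hnormal : Normal ℚ F := by
    have : Normal ℚ Ω := IsAlgClosure.normal ℚ Ω
    -- Embeddings permute `u ± v s`, so `f θ` is one of `±θ, ±θ'`; then `f θ'` is determined by the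
    -- product `w t`.
    suffices h : ∀ f : Ω →ₐ[ℚ] Ω, F.map f ≤ F by
      convert IntermediateField.normal_iff_forall_map_le.mpr h
      exact Subsingleton.elim _ _
    intro f
    have hfs : f s = s ∨ f s = -s := by
      rw [← sq_eq_sq_iff_eq_or_eq_neg, ← map_pow, hs, AlgHom.commutes]
    have hft : f t = t ∨ f t = -t := by
      rw [← sq_eq_sq_iff_eq_or_eq_neg, ← map_pow, ht, AlgHom.commutes]
    have hftF : f t ∈ F := by rcases hft with h | h <;> rw [h]; exacts [htF, neg_mem htF]
    have hfθ : f θ ∈ F := by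
      have : f θ ^ 2 = θ ^ 2 ∨ f θ ^ 2 = θ' ^ 2 := by
        rw [← map_pow, hθ, hθ'2]
        rcases hfs with h | h <;> simp [h, sub_eq_add_neg]
      rw [sq_eq_sq_iff_eq_or_eq_neg, sq_eq_sq_iff_eq_or_eq_neg] at this
      rcases this with (h | h) | (h | h) <;> rw [h]
      exacts [hθF, neg_mem hθF, hθ'F, neg_mem hθ'F]
    have hfθ' : f θ' ∈ F := by
      have hfθ0 : f θ ≠ 0 := (map_ne_zero f).mpr hθ0
      have : f θ' = algebraMap ℚ Ω w * f t / f θ := by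
        rw [eq_div_iff hfθ0, mul_comm, ← map_mul, hθ', map_mul, AlgHom.commutes]
      rw [this]
      exact div_mem (mul_mem (F.algebraMap_mem w) hftF) hfθ
    rw [IntermediateField.adjoin_map, IntermediateField.adjoin_le_iff]
    rintro _ ⟨x, rfl | rfl, rfl⟩
    exacts [hfθ, hfθ']
  have hGal : IsGalois ℚ F := ⟨⟩
  have hext : ∀ g : F ≃ₐ[ℚ] F, g ⟨θ, hθF⟩ = ⟨θ, hθF⟩ → g ⟨θ', hθ'F⟩ = ⟨θ', hθ'F⟩ → g = 1 := by
    intro g h1 h2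
    refine AlgEquiv.ext fun x => (apply_eq_of_mem_adjoin (S := {θ, θ'}) ?_ x x.2).2
    rintro x (rfl | rfl)
    exacts [⟨hθF, h1⟩, ⟨hθ'F, h2⟩]
  obtain ⟨h1, h2⟩ := exists_dihedral (F := F) (s := ⟨s, hsF⟩) (t := ⟨t, htF⟩) (θ := ⟨θ, hθF⟩)
    (θ' := ⟨θ', hθ'F⟩) (pow_eq_algebraMap_of_coe hs) (pow_eq_algebraMap_of_coe ht)
    ha hb hab hw huv
    (Subtype.ext (by push_cast; simpa only [coe_algebraMap_rat] using hθ))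
    (Subtype.ext (by push_cast; simpa only [coe_algebraMap_rat] using hθ')) hext
  exact ⟨F, ⟨hGal, h1⟩, hsF, htF, h2⟩

/-- The factor `c` and the flexible `K` let one statement cover all three subfields: for `(s₂,
s₁s₂)` the product is `d₂ s₁`, so `m = s₁` and `c = d₂`. -/
theorem inD4ExtensionCyclicOver_iff [IsAlgClosure ℚ Ω] {a b c : ℚ} {s t m : Ω}
    (hs : s ^ 2 = algebraMap ℚ Ω a) (ht : t ^ 2 = algebraMap ℚ Ω b)
    (ha : ¬ IsSquare a) (hb : ¬ IsSquare b) (hab : ¬ IsSquare (a * b))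
    (hc : c ≠ 0) (hm : s * t = algebraMap ℚ Ω c * m) {K : IntermediateField ℚ Ω}
    (hsK : s ∈ K) (htK : t ∈ K) (hK : K ≤ ℚ⟮s, t⟯) :
    InD4ExtensionCyclicOver K ℚ⟮m⟯ ↔ IsHilbertSolvable ℚ a b := by
  have hc' : algebraMap ℚ Ω c ≠ 0 := (map_ne_zero _).mpr hc
  have hm' : m = s * t / algebraMap ℚ Ω c := by rw [hm]; field_simp
  have hmem : ∀ {F : IntermediateField ℚ Ω}, s ∈ F → t ∈ F → m ∈ F := fun {F} hs ht => by
    rw [hm']; exact div_mem (mul_mem hs ht) (F.algebraMap_mem c)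
  have hfix : ∀ {F : IntermediateField ℚ Ω} (g : F ≃ₐ[ℚ] F) (hs : s ∈ F) (ht : t ∈ F)
      (hm : m ∈ F), g (⟨s, hs⟩ * ⟨t, ht⟩) = ⟨s, hs⟩ * ⟨t, ht⟩ ↔ g ⟨m, hm⟩ = ⟨m, hm⟩ := by
    intro F g hs ht hmF
    have h1 : (⟨s, hs⟩ * ⟨t, ht⟩ : F) = algebraMap ℚ F c * ⟨m, hmF⟩ := Subtype.ext (by
      push_cast; simpa only [coe_algebraMap_rat] using hm)
    rw [h1, map_mul, AlgEquiv.commutes, mul_right_inj' ((map_ne_zero _).mpr hc)]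
  constructor
  · rintro ⟨F, ⟨hGal, ⟨e⟩⟩, hKF, hcyc⟩
    have hmF := hmem (hKF hsK) (hKF htK)
    obtain ⟨ρ, hρ, hg⟩ := (isCyclicOver_adjoin_iff hmF).mp hcyc
    have hm2 : (⟨m, hmF⟩ : F) ^ 2 = algebraMap ℚ F (a * b / c ^ 2) := pow_eq_algebraMap_of_coe (by
      rw [hm', div_pow, mul_pow, hs, ht, map_div₀, map_mul, map_pow])
    exact isHilbertSolvable_of_dihedral e (s := ⟨s, hKF hsK⟩) (t := ⟨t, hKF htK⟩)
      (pow_eq_algebraMap_of_coe hs) (pow_eq_algebraMap_of_coe ht) ha hb hab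
      (mul_self_ne_one_of_forall_mem_zpowers e hm2 hg) ((hfix ρ _ _ hmF).mpr hρ)
  · intro h
    obtain ⟨F, hF, hsF, htF, ρ, hρ, hg⟩ :=
      exists_isD4Extension_of_isHilbertSolvable hs ht ha hb hab h
    have hmF := hmem hsF htF
    have := hF.1
    refine ⟨F, hF, hK.trans ?_, (isCyclicOver_adjoin_iff hmF).mpr
      ⟨ρ, (hfix ρ hsF htF hmF).mp hρ, fun g h => hg g ((hfix g hsF htF hmF).mpr h)⟩⟩
    rw [IntermediateField.adjoin_le_iff]
    rintro _ (rfl | rfl)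
    exacts [hsF, htF]

/-- A `D₄`-extension containing `√a` and `√b` yields a solution for one of the three pairs formed
from `a`, `b` and `a b`. -/
theorem isHilbertSolvable_of_isD4Extension {a b : ℚ} {s t : Ω}
    (hs : s ^ 2 = algebraMap ℚ Ω a) (ht : t ^ 2 = algebraMap ℚ Ω b)
    (ha : ¬ IsSquare a) (hb : ¬ IsSquare b) (hab : ¬ IsSquare (a * b))
    {F : IntermediateField ℚ Ω} (hF : IsD4Extension F) (hsF : s ∈ F) (htF : t ∈ F) :
    IsHilbertSolvable ℚ b (a * b) ∨ IsHilbertSolvable ℚ a (a * b) ∨ IsHilbertSolvable ℚ a b := by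
  obtain ⟨hGal, ⟨e⟩⟩ := hF
  obtain ⟨σ, hσ⟩ := e.surjective (.r 1)
  have hσ2 : σ * σ ≠ 1 := fun h => by
    have := congrArg e h
    rw [map_mul, map_one, hσ] at this
    revert this
    decide
  have hsq : ∀ {x y : ℚ}, x ≠ 0 → ¬ IsSquare y → ¬ IsSquare (x ^ 2 * y) := fun {x y} hx hy h => by
    obtain ⟨r, hr⟩ := h
    exact hy ⟨r / x, by field_simp; linear_combination hr⟩
  have ha0 : a ≠ 0 := by rintro rfl; exact ha (IsSquare.zero)
  have hb0 : b ≠ 0 := by rintro rfl; exact hb (IsSquare.zero)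
  set s' : F := ⟨s, hsF⟩
  set t' : F := ⟨t, htF⟩
  have hs' : s' ^ 2 = algebraMap ℚ F a := pow_eq_algebraMap_of_coe hs
  have ht' : t' ^ 2 = algebraMap ℚ F b := pow_eq_algebraMap_of_coe ht
  have hst' : (s' * t') ^ 2 = algebraMap ℚ F (a * b) := by rw [mul_pow, hs', ht', map_mul]
  -- The rotation `σ` fixes `s`, `t` or `st`. In each case the pair of roots is chosen so that their
  -- product is a rational multiple of the fixed one.
  rcases apply_eq_or_eq_neg σ hs' with h | h
  · refine .inl (isHilbertSolvable_of_dihedral e ht' hst' hb hab ?_ hσ2 ?_)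
    · rw [show b * (a * b) = b ^ 2 * a by ring]; exact hsq hb0 ha
    · rw [show t' * (s' * t') = t' ^ 2 * s' by ring, ht', map_mul, AlgEquiv.commutes, h]
  rcases apply_eq_or_eq_neg σ ht' with h' | h'
  · refine .inr (.inl (isHilbertSolvable_of_dihedral e hs' hst' ha hab ?_ hσ2 ?_))
    · rw [show a * (a * b) = a ^ 2 * b by ring]; exact hsq ha0 hb
    · rw [show s' * (s' * t') = s' ^ 2 * t' by ring, hs', map_mul, AlgEquiv.commutes, h']
  · exact .inr (.inr (isHilbertSolvable_of_dihedral e hs' ht' ha hb hab hσ2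
      (by rw [map_mul, h, h', neg_mul_neg])))

end Fields

/-! ### Admissible pairs -/

theorem not_isSquare_of_squarefree {d : ℤ} (hd : Squarefree d) (h1 : d ≠ 1) : ¬ IsSquare d := by
  rintro ⟨r, rfl⟩
  rcases Int.isUnit_iff.mp (hd r dvd_rfl) with rfl | rfl <;> simp at h1

theorem not_isSquare_mul_of_squarefree {d₁ d₂ : ℤ} (h₁ : Squarefree d₁) (h₂ : Squarefree d₂)
    (hne : d₁ ≠ d₂) : ¬ IsSquare (d₁ * d₂) := by
  rintro ⟨r, hr⟩
  obtain ⟨k, rfl⟩ : d₁ ∣ r :=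
    (h₁.dvd_pow_iff_dvd two_ne_zero).mp ⟨d₂, by rw [sq, ← hr]⟩
  have h : d₂ = d₁ * (k * k) := mul_left_cancel₀ h₁.ne_zero (by linear_combination hr)
  have hk := h₂ k (h ▸ dvd_mul_left _ _)
  rcases Int.isUnit_iff.mp hk with rfl | rfl <;> exact hne (by rw [h]; ring)

theorem hilbertTrivialEverywhere_iff {a b : ℤ} :
    HilbertTrivialEverywhere a b ↔ IsLocallySolvable a b := by
  simp only [HilbertTrivialEverywhere, hilbertInfinity, hilbertPrime, hilbertSymbol_eq_one_iff,
    IsLocallySolvable]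

theorem isHilbertSolvable_mul_iff_neg {k : Type*} [Field k] [CharZero k] {a b : ℤ} (ha : a ≠ 0) :
    IsHilbertSolvable k (a : k) ((a * b : ℤ) : k) ↔
      IsHilbertSolvable k (a : k) ((-b : ℤ) : k) := by
  push_cast
  exact IsHilbertSolvable.mul_iff (by exact_mod_cast ha)

theorem isHilbertSolvable_real_int_iff {a b : ℤ} (ha : a ≠ 0) (hb : b ≠ 0) :
    IsHilbertSolvable ℝ (a : ℝ) (b : ℝ) ↔ (a.sign, b.sign) ≠ (-1, -1) := by
  rw [isHilbertSolvable_real_iff (by exact_mod_cast ha) (by exact_mod_cast hb)]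
  simp only [Int.cast_pos, ne_eq, Prod.mk.injEq, Int.sign_eq_neg_one_iff_neg]
  omega

end BiquadraticD4

/-! ### Assembly of the local, global and Galois-theoretic results. -/

open BiquadraticD4 in
theorem mainTheorem5 (Ω : Type*) [Field Ω] [Algebra ℚ Ω] [IsAlgClosure ℚ Ω]
    (d₁ d₂ : ℤ) (hd : IsAdmissiblePair d₁ d₂)
    (s₁ s₂ : Ω) (hs₁ : s₁ ^ 2 = (d₁ : Ω)) (hs₂ : s₂ ^ 2 = (d₂ : Ω)) :
    -- containment in some `D₄`-extension
    (InD4Extension ℚ⟮s₁, s₂⟯ ↔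
      conditionsFst d₁ d₂ ∨ conditionsSnd d₁ d₂ ∨ conditionsProd d₁ d₂) ∧
    -- containment in a `D₄`-extension that is cyclic over a given quadratic subfield
    (InD4ExtensionCyclicOver ℚ⟮s₁, s₂⟯ ℚ⟮s₁⟯ ↔ conditionsFst d₁ d₂) ∧
    (InD4ExtensionCyclicOver ℚ⟮s₁, s₂⟯ ℚ⟮s₂⟯ ↔ conditionsSnd d₁ d₂) ∧
    (InD4ExtensionCyclicOver ℚ⟮s₁, s₂⟯ ℚ⟮s₁ * s₂⟯ ↔ conditionsProd d₁ d₂) ∧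
    -- the corresponding conditions on Hilbert symbols, globally
    (InD4ExtensionCyclicOver ℚ⟮s₁, s₂⟯ ℚ⟮s₁⟯ ↔ HilbertTrivialEverywhere d₂ (d₁ * d₂)) ∧
    (InD4ExtensionCyclicOver ℚ⟮s₁, s₂⟯ ℚ⟮s₂⟯ ↔ HilbertTrivialEverywhere d₁ (d₁ * d₂)) ∧
    (InD4ExtensionCyclicOver ℚ⟮s₁, s₂⟯ ℚ⟮s₁ * s₂⟯ ↔ HilbertTrivialEverywhere d₁ d₂) ∧
    -- and place by place
    (((d₁.sign, d₂.sign) ≠ (1, -1) ↔ hilbertInfinity d₂ (d₁ * d₂) = 1) ∧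
      ∀ (p : ℕ) [Fact p.Prime],
        (localConditionFst d₁ d₂ p ↔ hilbertPrime p d₂ (d₁ * d₂) = 1)) ∧
    (((d₁.sign, d₂.sign) ≠ (-1, 1) ↔ hilbertInfinity d₁ (d₁ * d₂) = 1) ∧
      ∀ (p : ℕ) [Fact p.Prime],
        (localConditionSnd d₁ d₂ p ↔ hilbertPrime p d₁ (d₁ * d₂) = 1)) ∧
    (((d₁.sign, d₂.sign) ≠ (-1, -1) ↔ hilbertInfinity d₁ d₂ = 1) ∧
      ∀ (p : ℕ) [Fact p.Prime],
        (localConditionProd d₁ d₂ p ↔ hilbertPrime p d₁ d₂ = 1)) := by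
  obtain ⟨hsf₁, hsf₂, h1₁, h1₂, hne⟩ := hd
  have h0₁ := hsf₁.ne_zero
  have h0₂ := hsf₂.ne_zero
  have hneg₁ : Squarefree (-d₁) := by rwa [← Int.squarefree_natAbs, Int.natAbs_neg,
    Int.squarefree_natAbs]
  have hneg₂ : Squarefree (-d₂) := by rwa [← Int.squarefree_natAbs, Int.natAbs_neg,
    Int.squarefree_natAbs]
  -- After this rewriting both entries are square-free, as the tables and the Hasse principle
  -- require. It is applied over `ℚ`, `ℝ` and each `ℚ_[p]`.
  have eFst : ∀ (k : Type) [Field k] [CharZero k],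
      IsHilbertSolvable k (d₂ : k) ((d₁ * d₂ : ℤ) : k) ↔
        IsHilbertSolvable k ((-d₁ : ℤ) : k) (d₂ : k) := fun k _ _ => by
    rw [mul_comm, isHilbertSolvable_mul_iff_neg h0₂, IsHilbertSolvable.comm]
  have eSnd : ∀ (k : Type) [Field k] [CharZero k],
      IsHilbertSolvable k (d₁ : k) ((d₁ * d₂ : ℤ) : k) ↔
        IsHilbertSolvable k (d₁ : k) ((-d₂ : ℤ) : k) := fun k _ _ =>
    isHilbertSolvable_mul_iff_neg h0₁
  -- the places
  have iFst : (d₁.sign, d₂.sign) ≠ (1, -1) ↔ hilbertInfinity d₂ (d₁ * d₂) = 1 := by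
    rw [hilbertInfinity, hilbertSymbol_eq_one_iff, eFst,
      isHilbertSolvable_real_int_iff hneg₁.ne_zero h0₂, Int.sign_neg]
    simp only [ne_eq, Prod.mk.injEq, neg_inj]
  have iSnd : (d₁.sign, d₂.sign) ≠ (-1, 1) ↔ hilbertInfinity d₁ (d₁ * d₂) = 1 := by
    rw [hilbertInfinity, hilbertSymbol_eq_one_iff, eSnd,
      isHilbertSolvable_real_int_iff h0₁ hneg₂.ne_zero, Int.sign_neg]
    simp only [ne_eq, Prod.mk.injEq, neg_inj]
  have iProd : (d₁.sign, d₂.sign) ≠ (-1, -1) ↔ hilbertInfinity d₁ d₂ = 1 := by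
    rw [hilbertInfinity, hilbertSymbol_eq_one_iff, isHilbertSolvable_real_int_iff h0₁ h0₂]
  have pFst : ∀ (p : ℕ) [Fact p.Prime],
      (localConditionFst d₁ d₂ p ↔ hilbertPrime p d₂ (d₁ * d₂) = 1) := fun p _ => by
    rw [hilbertPrime, hilbertSymbol_eq_one_iff, eFst, localConditionFst_iff_prod hsf₁ hsf₂,
      localConditionProd_iff hneg₁ hsf₂]
  have pSnd : ∀ (p : ℕ) [Fact p.Prime],
      (localConditionSnd d₁ d₂ p ↔ hilbertPrime p d₁ (d₁ * d₂) = 1) := fun p _ => by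
    rw [hilbertPrime, hilbertSymbol_eq_one_iff, eSnd, localConditionSnd_iff_prod hsf₁ hsf₂,
      localConditionProd_iff hsf₁ hneg₂]
  have pProd : ∀ (p : ℕ) [Fact p.Prime],
      (localConditionProd d₁ d₂ p ↔ hilbertPrime p d₁ d₂ = 1) := fun p _ => by
    rw [hilbertPrime, hilbertSymbol_eq_one_iff, localConditionProd_iff hsf₁ hsf₂]
  have cFst : conditionsFst d₁ d₂ ↔ HilbertTrivialEverywhere d₂ (d₁ * d₂) :=
    and_congr iFst (forall_congr' fun p => forall_congr' fun hp => @pFst p ⟨hp⟩) |>.trans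
      ⟨fun h => ⟨h.1, fun p hp => h.2 p hp.out⟩, fun h => ⟨h.1, fun p hp => @h.2 p ⟨hp⟩⟩⟩
  have cSnd : conditionsSnd d₁ d₂ ↔ HilbertTrivialEverywhere d₁ (d₁ * d₂) :=
    and_congr iSnd (forall_congr' fun p => forall_congr' fun hp => @pSnd p ⟨hp⟩) |>.trans
      ⟨fun h => ⟨h.1, fun p hp => h.2 p hp.out⟩, fun h => ⟨h.1, fun p hp => @h.2 p ⟨hp⟩⟩⟩
  have cProd : conditionsProd d₁ d₂ ↔ HilbertTrivialEverywhere d₁ d₂ :=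
    and_congr iProd (forall_congr' fun p => forall_congr' fun hp => @pProd p ⟨hp⟩) |>.trans
      ⟨fun h => ⟨h.1, fun p hp => h.2 p hp.out⟩, fun h => ⟨h.1, fun p hp => @h.2 p ⟨hp⟩⟩⟩
  -- the Hasse principle
  have gFst : IsHilbertSolvable ℚ (d₂ : ℚ) ((d₁ * d₂ : ℤ) : ℚ) ↔
      HilbertTrivialEverywhere d₂ (d₁ * d₂) := by
    rw [hilbertTrivialEverywhere_iff, eFst, isHilbertSolvable_rat_iff hneg₁ hsf₂]
    exact and_congr (eFst ℝ).symm (forall_congr' fun p => forall_congr' fun _ => (eFst ℚ_[p]).symm)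
  have gSnd : IsHilbertSolvable ℚ (d₁ : ℚ) ((d₁ * d₂ : ℤ) : ℚ) ↔
      HilbertTrivialEverywhere d₁ (d₁ * d₂) := by
    rw [hilbertTrivialEverywhere_iff, eSnd, isHilbertSolvable_rat_iff hsf₁ hneg₂]
    exact and_congr (eSnd ℝ).symm (forall_congr' fun p => forall_congr' fun _ => (eSnd ℚ_[p]).symm)
  have gProd : IsHilbertSolvable ℚ (d₁ : ℚ) (d₂ : ℚ) ↔ HilbertTrivialEverywhere d₁ d₂ := by
    rw [hilbertTrivialEverywhere_iff, isHilbertSolvable_rat_iff hsf₁ hsf₂]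
  -- the fields
  have hs₁' : s₁ ^ 2 = algebraMap ℚ Ω d₁ := by rw [hs₁, map_intCast]
  have hs₂' : s₂ ^ 2 = algebraMap ℚ Ω d₂ := by rw [hs₂, map_intCast]
  have hs₁₂ : (s₁ * s₂) ^ 2 = algebraMap ℚ Ω ((d₁ * d₂ : ℤ) : ℚ) := by
    rw [mul_pow, hs₁', hs₂', ← map_mul, Int.cast_mul]
  have hn₁ : ¬ IsSquare (d₁ : ℚ) := by
    rw [Rat.isSquare_intCast_iff]; exact not_isSquare_of_squarefree hsf₁ h1₁
  have hn₂ : ¬ IsSquare (d₂ : ℚ) := by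
    rw [Rat.isSquare_intCast_iff]; exact not_isSquare_of_squarefree hsf₂ h1₂
  have hn₁₂ : ¬ IsSquare ((d₁ * d₂ : ℤ) : ℚ) := by
    rw [Rat.isSquare_intCast_iff]; exact not_isSquare_mul_of_squarefree hsf₁ hsf₂ hne
  have hq₁ : (d₁ : ℚ) ≠ 0 := by exact_mod_cast h0₁
  have hq₂ : (d₂ : ℚ) ≠ 0 := by exact_mod_cast h0₂
  have hne₁ := ne_zero_of_not_isSquare hs₁' hn₁
  have hne₂ := ne_zero_of_not_isSquare hs₂' hn₂
  have hsq : ∀ {x y : ℚ}, x ≠ 0 → ¬ IsSquare y → ¬ IsSquare (x ^ 2 * y) := fun {x y} hx hy h => by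
    obtain ⟨r, hr⟩ := h
    exact hy ⟨r / x, by field_simp; linear_combination hr⟩
  have m₁ : s₁ ∈ ℚ⟮s₁, s₂⟯ := IntermediateField.subset_adjoin _ _ (by simp)
  have m₂ : s₂ ∈ ℚ⟮s₁, s₂⟯ := IntermediateField.subset_adjoin _ _ (by simp)
  have fFst : InD4ExtensionCyclicOver ℚ⟮s₁, s₂⟯ ℚ⟮s₁⟯ ↔
      HilbertTrivialEverywhere d₂ (d₁ * d₂) := by
    rw [← gFst]
    refine inD4ExtensionCyclicOver_iff hs₂' hs₁₂ hn₂ hn₁₂ ?_ hq₂ ?_ m₂ (mul_mem m₁ m₂) ?_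
    · rw [Int.cast_mul, show (d₂ * (d₁ * d₂) : ℚ) = (d₂ : ℚ) ^ 2 * d₁ by ring]
      exact hsq hq₂ hn₁
    · rw [← hs₂']; ring
    · have h1 : s₂ ∈ ℚ⟮s₂, s₁ * s₂⟯ := IntermediateField.subset_adjoin _ _ (by simp)
      have h2 : s₁ * s₂ ∈ ℚ⟮s₂, s₁ * s₂⟯ := IntermediateField.subset_adjoin _ _ (by simp)
      rw [IntermediateField.adjoin_le_iff]
      rintro _ (rfl | rfl)
      · simpa [hne₂] using div_mem h2 h1
      · exact h1
  have fSnd : InD4ExtensionCyclicOver ℚ⟮s₁, s₂⟯ ℚ⟮s₂⟯ ↔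
      HilbertTrivialEverywhere d₁ (d₁ * d₂) := by
    rw [← gSnd]
    refine inD4ExtensionCyclicOver_iff hs₁' hs₁₂ hn₁ hn₁₂ ?_ hq₁ ?_ m₁ (mul_mem m₁ m₂) ?_
    · rw [Int.cast_mul, show (d₁ * (d₁ * d₂) : ℚ) = (d₁ : ℚ) ^ 2 * d₂ by ring]
      exact hsq hq₁ hn₂
    · rw [← hs₁']; ring
    · have h1 : s₁ ∈ ℚ⟮s₁, s₁ * s₂⟯ := IntermediateField.subset_adjoin _ _ (by simp)
      have h2 : s₁ * s₂ ∈ ℚ⟮s₁, s₁ * s₂⟯ := IntermediateField.subset_adjoin _ _ (by simp)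
      rw [IntermediateField.adjoin_le_iff]
      rintro _ (rfl | rfl)
      · exact h1
      · simpa [hne₁] using div_mem h2 h1
  have fProd : InD4ExtensionCyclicOver ℚ⟮s₁, s₂⟯ ℚ⟮s₁ * s₂⟯ ↔ HilbertTrivialEverywhere d₁ d₂ := by
    rw [← gProd]
    exact inD4ExtensionCyclicOver_iff hs₁' hs₂' hn₁ hn₂ (by rwa [← Int.cast_mul]) one_ne_zero
      (by simp) m₁ m₂ le_rfl
  refine ⟨⟨?_, ?_⟩, fFst.trans cFst.symm, fSnd.trans cSnd.symm, fProd.trans cProd.symm, fFst, fSnd,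
    fProd, ⟨iFst, pFst⟩, ⟨iSnd, pSnd⟩, ⟨iProd, pProd⟩⟩
  · rintro ⟨F, hF, hKF⟩
    rw [cFst, cSnd, cProd, ← gFst, ← gSnd, ← gProd, Int.cast_mul]
    exact isHilbertSolvable_of_isD4Extension hs₁' hs₂' hn₁ hn₂ (by rwa [← Int.cast_mul]) hF
      (hKF m₁) (hKF m₂)
  · rw [cFst, cSnd, cProd, ← fFst, ← fSnd, ← fProd]
    rintro (⟨F, hF, hKF, -⟩ | ⟨F, hF, hKF, -⟩ | ⟨F, hF, hKF, -⟩) <;> exact ⟨F, hF, hKF⟩
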